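/- **Definitions.** *Lattices.* A Garside lattice is a pair $(L,\varphi)$ where $L$ is a non-empty lattice, $\varphi$ is an automorphism of $L$ with $x\le\varphi(x)$ for all $x$, for all $x,y\in L$ there is $k\in\mathbb N$ with $x\le\varphi^k(y)$, and $L$ is homogeneous, that is, it has a length function: a function $\ell$ from the pairs $a\le b$ of $L$ to $\mathbb Z_{\ge0}$ such that $\ell(a\le c)=\ell(a\le b)+\ell(b\le c)$ for $a\le b\le c$, and $\ell(a\le b)=0$ if and only if $a=b$. A length function is invariant if $\ell(\varphi(a)\le\varphi(b))=\ell(a\le b)$ for all $a\le b$. Isomorphisms are the lattice isomorphisms commuting with the automorphisms. *Categories.* Let $\mathcal C$ be a small category, with composition written from left to right. A length function on $\mathcal C$ is a function $l$ from the morphisms to $\mathbb Z_{\ge0}$ with $l(fg)=l(f)+l(g)$, and $l(f)=0$ if and only if $f$ is an identity. $\mathcal C$ is cancellative if $afb=agb$ implies $f=g$. An atom is a non-identity morphism which is not a product of two non-identity morphisms. A categorical Garside structure is a triple $(\mathcal C,\phi,\Delta)$ where $\phi$ is an automorphism of $\mathcal C$ and $\Delta$ is a natural transformation from the identity functor to $\phi$,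 such that: $\mathcal C$ has a length function and is cancellative; for each atom $f:x\to y$ there is $g:y\to\phi(x)$ with $fg=\Delta_x$; and for each object $x$, the morphisms with source $x$ ordered by $f\preceq fh$, and the morphisms with target $x$ ordered by $f\preceq hf$, are lattices. It is special if there is at most one morphism from any object to any other and the nerve of $\mathcal C$ is simply connected; it is connected if $\mathcal C$ is a connected category. A length function is invariant if $l(\phi(f))=l(f)$ for all $f$. Isomorphisms are the isomorphisms of categories that commute with the automorphisms and carry one natural transformation to the other. *Complexes.* Let $X$ be a simply connected flag simplicial complex with a total order on each simplex, consistent with passing to faces, and let $\varphi$ be an order-preserving automorphism of $X$. Write $a<b$ if $a,b$ are adjacent vertices and $a$ precedes $b$ on the edge joining them, and $a\le b$ if $a<b$ or $a=b$. Assume that $a\le b$ if and only if $b\le\varphi(a)$, for all vertices $a,b$, and that for each vertex $x$ the set of vertices $z$ with $x\le z$ and $z\le\varphi(x)$ is a lattice under $\le$. A labeling of $X$ is a function $\lambda$ from the edges to $\mathbb Z_{>0}$ with $\lambda(ab)+\lambda(bc)=\lambda(ac)$ for each $2$-simplex with vertices $a<b<c$. It is invariant if $\varphi$ preserves it. $(X,\varphi)$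 is a Garside flag complex if it has an invariant labeling, and a weak Garside flag complex if it has a labeling, invariant or not. Isomorphisms are the simplicial isomorphisms that preserve the orders and commute with the automorphisms. *Constructions.* To a pair $(L,\varphi)$ of a lattice and an automorphism with $x\le\varphi(x)$ for all $x$, associate the triple $(\mathcal C_L,\phi_L,\Delta_L)$: the objects are the elements of $L$, there is exactly one morphism from $x$ to $y$ if $x\le y$ and none otherwise, $\phi_L$ is induced by $\varphi$, and $\Delta_L$ at $x$ is the morphism $x\le\varphi(x)$. Associate also the complex $(X_L,\varphi)$: the vertices are the elements of $L$, and the simplices are the chains $x_0<\dots<x_k$ with $x_k\le\varphi(x_0)$, ordered as in $L$. **Theorem 4.7 (Theorem H).** Connected special categorical Garside structures, Garside lattices and Garside flag complexes are in one-to-one correspondence up to isomorphism, with the length functions and labelings either required to be invariant on all three sides or on none of them. Precisely: 1. $(L,\varphi)\mapsto(\mathcal C_L,\phi_L,\Delta_L)$ induces a bijection from the isomorphism classes of Garside lattices onto the isomorphism classes of connected special categorical Garside structures. 2. It also induces a bijection from the isomorphism classes of Garside lattices that have an invariant length function onto the isomorphism classes of connected special categorical Garside structures that have an invariant length function. 3.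 $(L,\varphi)\mapsto(X_L,\varphi)$ induces a bijection from the isomorphism classes of Garside lattices that have an invariant length function onto the isomorphism classes of Garside flag complexes. 4. It also induces a bijection from the isomorphism classes of Garside lattices onto the isomorphism classes of weak Garside flag complexes. 5. For each Garside lattice $(L,\varphi)$: a function $\ell$ on the pairs $a\le b$ is a length function on $L$ (resp. is invariant) if and only if the same function on the morphisms of $\mathcal C_L$ is a length function (resp. is invariant); restriction to the edges of $X_L$ is a bijection from the length functions on $L$ onto the labelings of $X_L$; and a length function on $L$ is invariant if and only if its restriction is. -/

import Mathlib

open CategoryTheory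

universe u

namespace Garside

/-! ### General notions -/

/-- The binary relation `r` makes `α` a lattice: it is a partial order, and any two elements have
a join (least upper bound) and a meet (greatest lower bound). -/
structure IsLatticeRel {α : Type*} (r : α → α → Prop) : Prop where
  refl : ∀ a, r a a
  antisymm : ∀ a b, r a b → r b a → a = b
  trans : ∀ a b c, r a b → r b c → r a c
  join : ∀ a b, ∃ j, r a j ∧ r b j ∧ ∀ c, r a c → r b c → r j c
  meet : ∀ a b, ∃ m, r m a ∧ r m b ∧ ∀ c, r c a → r c b → r c m

/-- The construction `K : A → B` induces a bijection from the isomorphism classes of the objects of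
`A` with property `PA` onto the isomorphism classes of the objects of `B` with property `PB`:
it maps `PA` into `PB`, two objects are isomorphic exactly when their images are,
and every object with `PB` is isomorphic to the image of an object with `PA`. -/
structure BijectionUpToIso {A B : Type*} (isoA : A → A → Prop) (isoB : B → B → Prop)
    (PA : A → Prop) (PB : B → Prop) (K : A → B) : Prop where
  maps_to : ∀ a, PA a → PB (K a)
  iso_iff : ∀ a a', PA a → PA a' → (isoA a a' ↔ isoB (K a) (K a'))
  surjective : ∀ b, PB b → ∃ a, PA a ∧ isoB (K a) b

/-! ### Simply connected simplicial sets, by means of edge paths -/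

/-- The 0-simplices of a simplicial set. -/
abbrev Vertex (X : SSet.{u}) : Type u := X.obj (Opposite.op (SimplexCategory.mk 0))

/-- An edge path in a simplicial set: a finite sequence of consecutive edges, each of them
traversed forwards or backwards. -/
inductive EdgePath (X : SSet.{u}) : Vertex X → Vertex X → Type u where
  | nil (x : Vertex X) : EdgePath X x x
  | fwd {x y z : Vertex X} (e : SSet.Edge x y) (p : EdgePath X y z) : EdgePath X x z
  | bwd {x y z : Vertex X} (e : SSet.Edge y x) (p : EdgePath X y z) : EdgePath X x z

/-- Homotopy of edge paths with fixed endpoints: the congruence generated by cancelling an edge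
traversed back and forth, and by replacing two consecutive edges of a 2-simplex by the third one.
(Degenerate 2-simplices make degenerate edges homotopic to constant paths.) -/
inductive EdgePath.Homotopic {X : SSet.{u}} :
    ∀ {x y : Vertex X}, EdgePath X x y → EdgePath X x y → Prop where
  | refl {x y : Vertex X} (p : EdgePath X x y) : Homotopic p p
  | symm {x y : Vertex X} {p q : EdgePath X x y} : Homotopic p q → Homotopic q p
  | trans {x y : Vertex X} {p q r : EdgePath X x y} :
      Homotopic p q → Homotopic q r → Homotopic p r
  | fwd_congr {x y z : Vertex X} (e : SSet.Edge x y) {p q : EdgePath X y z} :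
      Homotopic p q → Homotopic (.fwd e p) (.fwd e q)
  | bwd_congr {x y z : Vertex X} (e : SSet.Edge y x) {p q : EdgePath X y z} :
      Homotopic p q → Homotopic (.bwd e p) (.bwd e q)
  | fwd_bwd {x y z : Vertex X} (e : SSet.Edge x y) (p : EdgePath X x z) :
      Homotopic (.fwd e (.bwd e p)) p
  | bwd_fwd {x y z : Vertex X} (e : SSet.Edge y x) (p : EdgePath X x z) :
      Homotopic (.bwd e (.fwd e p)) p
  | triangle {x₀ x₁ x₂ z : Vertex X} {e₀₁ : SSet.Edge x₀ x₁} {e₁₂ : SSet.Edge x₁ x₂}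
      {e₀₂ : SSet.Edge x₀ x₂} (σ : SSet.Edge.CompStruct e₀₁ e₁₂ e₀₂) (p : EdgePath X x₂ z) :
      Homotopic (.fwd e₀₁ (.fwd e₁₂ p)) (.fwd e₀₂ p)

/-- A simplicial set is simply connected if it is non-empty and connected, and every closed edge
path is null-homotopic. -/
structure IsSimplyConnectedSSet (X : SSet.{u}) : Prop where
  nonempty : Nonempty (Vertex X)
  connected : ∀ x y : Vertex X, Nonempty (EdgePath X x y)
  null_homotopic : ∀ (x : Vertex X) (p : EdgePath X x x), p.Homotopic (.nil x)

/-! ### Simply connected flag simplicial complexes -/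

/-- The 1-skeleton of a simplicial complex, as a graph. -/
def oneSkeleton {V : Type u} (X : AbstractSimplicialComplex V) : SimpleGraph V where
  Adj a b := a ≠ b ∧ ∃ s ∈ X.faces, a ∈ s ∧ b ∈ s
  symm := ⟨fun _ _ h => ⟨h.1.symm, h.2.imp fun _ hs => ⟨hs.1, hs.2.2, hs.2.1⟩⟩⟩
  loopless := ⟨fun _ h => h.1 rfl⟩

/-- A simplicial complex is flag if every non-empty finite set of pairwise adjacent vertices
is a simplex. -/
def IsFlag {V : Type u} (X : AbstractSimplicialComplex V) : Prop :=
  ∀ s : Finset V, s.Nonempty →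
    (∀ a ∈ s, ∀ b ∈ s, a ≠ b → (oneSkeleton X).Adj a b) → s ∈ X.faces

/-- Homotopy of edge paths in a simplicial complex, with fixed endpoints: the congruence generated
by removing a backtrack, and by replacing two edges of a 2-simplex by the third one. -/
inductive WalkHomotopic {V : Type u} (X : AbstractSimplicialComplex V) :
    ∀ {a b : V}, (oneSkeleton X).Walk a b → (oneSkeleton X).Walk a b → Prop where
  | refl {a b : V} (p : (oneSkeleton X).Walk a b) : WalkHomotopic X p p
  | symm {a b : V} {p q : (oneSkeleton X).Walk a b} : WalkHomotopic X p q → WalkHomotopic X q p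
  | trans {a b : V} {p q r : (oneSkeleton X).Walk a b} :
      WalkHomotopic X p q → WalkHomotopic X q r → WalkHomotopic X p r
  | cons_congr {a b c : V} (h : (oneSkeleton X).Adj a b) {p q : (oneSkeleton X).Walk b c} :
      WalkHomotopic X p q → WalkHomotopic X (.cons h p) (.cons h q)
  | backtrack {a b c : V} (h : (oneSkeleton X).Adj a b) (h' : (oneSkeleton X).Adj b a)
      (p : (oneSkeleton X).Walk a c) : WalkHomotopic X (.cons h (.cons h' p)) p
  | triangle {a b c d : V} (hab : (oneSkeleton X).Adj a b) (hbc : (oneSkeleton X).Adj b c)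
      (hac : (oneSkeleton X).Adj a c) (hs : ∃ s ∈ X.faces, a ∈ s ∧ b ∈ s ∧ c ∈ s)
      (p : (oneSkeleton X).Walk c d) :
      WalkHomotopic X (.cons hab (.cons hbc p)) (.cons hac p)

/-- A simplicial complex is simply connected if it is non-empty and connected, and every closed
edge path is null-homotopic. -/
structure IsSimplyConnectedComplex {V : Type u} (X : AbstractSimplicialComplex V) : Prop where
  connected : (oneSkeleton X).Connected
  null_homotopic : ∀ (a : V) (p : (oneSkeleton X).Walk a a), WalkHomotopic X p .nil

/-! ### Categorical Garside structures -/

/-- A small category with an automorphism `φ` and a natural transformation `Δ` from the identity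
functor to `φ`. -/
structure CatTriple : Type (u + 1) where
  Obj : Type u
  [cat : SmallCategory Obj]
  φ : Obj ⥤ Obj
  φInv : Obj ⥤ Obj
  φ_φInv : φ ⋙ φInv = 𝟭 Obj
  φInv_φ : φInv ⋙ φ = 𝟭 Obj
  Δ : 𝟭 Obj ⟶ φ

attribute [instance] CatTriple.cat

namespace CatTriple

/-- An isomorphism of categories which commutes with the automorphisms and carries one natural
transformation to the other. -/
def Iso (T T' : CatTriple.{u}) : Prop :=
  ∃ (F : T.Obj ⥤ T'.Obj) (G : T'.Obj ⥤ T.Obj), F ⋙ G = 𝟭 T.Obj ∧ G ⋙ F = 𝟭 T'.Obj ∧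
    T.φ ⋙ F = F ⋙ T'.φ ∧ ∀ x : T.Obj, F.map (T.Δ.app x) ≍ T'.Δ.app (F.obj x)

variable (T : CatTriple.{u})

/-- Units of the category are the identity morphisms. -/
def IsUnitMor {x y : T.Obj} (f : x ⟶ y) : Prop := ∃ h : x = y, f = eqToHom h

/-- Length functions on the morphisms. -/
structure IsLength (l : ∀ ⦃x y : T.Obj⦄, (x ⟶ y) → ℕ) : Prop where
  comp : ∀ ⦃x y z : T.Obj⦄ (f : x ⟶ y) (g : y ⟶ z), l (f ≫ g) = l f + l g
  eq_zero_iff : ∀ ⦃x y : T.Obj⦄ (f : x ⟶ y), l f = 0 ↔ T.IsUnitMor f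

/-- The function `l` on morphisms is preserved by `φ`. -/
def IsInvariant (l : ∀ ⦃x y : T.Obj⦄, (x ⟶ y) → ℕ) : Prop :=
  ∀ ⦃x y : T.Obj⦄ (f : x ⟶ y), l (T.φ.map f) = l f

def IsCancellative : Prop :=
  ∀ ⦃w x y z : T.Obj⦄ (a : w ⟶ x) (f g : x ⟶ y) (b : y ⟶ z), a ≫ f ≫ b = a ≫ g ≫ b → f = g

/-- An atom is a nontrivial morphism which is not a product of two nontrivial morphisms. -/
def IsAtom {x y : T.Obj} (f : x ⟶ y) : Prop :=
  ¬ T.IsUnitMor f ∧ ∀ (z : T.Obj) (g : x ⟶ z) (h : z ⟶ y), g ≫ h = f →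
    T.IsUnitMor g ∨ T.IsUnitMor h

/-- A morphism from `x` is simple if it is a left factor of `Δ` at `x`. -/
def IsSimple {x y : T.Obj} (f : x ⟶ y) : Prop := ∃ g : y ⟶ T.φ.obj x, f ≫ g = T.Δ.app x

/-- The left divisibility relation on the morphisms with source `x`. -/
def LeftDvd (x : T.Obj) (f g : Σ y : T.Obj, x ⟶ y) : Prop := ∃ h : f.1 ⟶ g.1, f.2 ≫ h = g.2

/-- The right divisibility relation on the morphisms with target `x`. -/
def RightDvd (x : T.Obj) (f g : Σ y : T.Obj, y ⟶ x) : Prop := ∃ h : g.1 ⟶ f.1, h ≫ f.2 = g.2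

/-- (Homogeneous) categorical Garside structures. -/
structure IsGarside : Prop where
  homogeneous : ∃ l : ∀ ⦃x y : T.Obj⦄, (x ⟶ y) → ℕ, T.IsLength l
  cancellative : T.IsCancellative
  simple_of_atom : ∀ ⦃x y : T.Obj⦄ (f : x ⟶ y), T.IsAtom f → T.IsSimple f
  lattice_from : ∀ x : T.Obj, IsLatticeRel (T.LeftDvd x)
  lattice_to : ∀ x : T.Obj, IsLatticeRel (T.RightDvd x)

/-- Special: at most one morphism from an object to another, and simply connected nerve. -/
structure IsSpecial : Prop where
  thin : ∀ ⦃x y : T.Obj⦄ (f g : x ⟶ y), f = g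
  nerve_simplyConnected : IsSimplyConnectedSSet (nerve T.Obj)

/-- Connected special categorical Garside structures. -/
def IsConnectedSpecialGarside : Prop :=
  IsConnected T.Obj ∧ T.IsGarside ∧ T.IsSpecial

/-- Connected special categorical Garside structures with a `φ`-invariant length function. -/
def IsEquivariantConnectedSpecialGarside : Prop :=
  T.IsConnectedSpecialGarside ∧
    ∃ l : ∀ ⦃x y : T.Obj⦄, (x ⟶ y) → ℕ, T.IsLength l ∧ T.IsInvariant l

end CatTriple

/-! ### Garside lattices -/

/-- A lattice with an increasing automorphism. -/
structure LatticePair : Type (u + 1) where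
  L : Type u
  [lat : Lattice L]
  φ : L ≃o L
  le_φ : ∀ x, x ≤ φ x

attribute [instance] LatticePair.lat

namespace LatticePair

/-- An isomorphism of lattices commuting with the automorphisms. -/
def Iso (A A' : LatticePair.{u}) : Prop :=
  ∃ e : A.L ≃o A'.L, ∀ x, e (A.φ x) = A'.φ (e x)

variable (A : LatticePair.{u})

/-- The comparable pairs `a ≤ b`. -/
abbrev Pair : Type u := {p : A.L × A.L // p.1 ≤ p.2}

/-- Length functions on the comparable pairs. -/
structure IsLength (l : A.Pair → ℕ) : Prop where
  add : ∀ (a b c : A.L) (hab : a ≤ b) (hbc : b ≤ c),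
    l ⟨(a, c), hab.trans hbc⟩ = l ⟨(a, b), hab⟩ + l ⟨(b, c), hbc⟩
  eq_zero_iff : ∀ p : A.Pair, l p = 0 ↔ p.1.1 = p.1.2

/-- The function `l` on comparable pairs is preserved by `φ`. -/
def IsInvariant (l : A.Pair → ℕ) : Prop :=
  ∀ (a b : A.L) (hab : a ≤ b), l ⟨(A.φ a, A.φ b), A.φ.monotone hab⟩ = l ⟨(a, b), hab⟩

/-- Garside lattices: `L` is homogeneous, and `φ` moves every element above every other one. -/
structure IsGarside : Prop where
  nonempty : Nonempty A.L
  homogeneous : ∃ l : A.Pair → ℕ, A.IsLength l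
  cofinal : ∀ x y : A.L, ∃ k : ℕ, x ≤ A.φ^[k] y

/-- Garside lattices with a `φ`-invariant length function. -/
def IsEquivariantGarside : Prop :=
  A.IsGarside ∧ ∃ l : A.Pair → ℕ, A.IsLength l ∧ A.IsInvariant l

end LatticePair

/-! ### Garside flag complexes -/

/-- A simplicial complex with vertex set `V`, a consistent total order on each simplex and an
order-preserving automorphism `φ`. The orders are given by the relation `lt` on `V`, where `lt a b`
means that `a` and `b` are adjacent and that `a` precedes `b` on the edge connecting them. -/
structure OrderedComplex : Type (u + 1) where
  V : Type u
  X : AbstractSimplicialComplex V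
  lt : V → V → Prop
  lt_adj : ∀ a b, lt a b → (oneSkeleton X).Adj a b
  lt_trans : ∀ s ∈ X.faces, ∀ a ∈ s, ∀ b ∈ s, ∀ c ∈ s, lt a b → lt b c → lt a c
  lt_total : ∀ s ∈ X.faces, ∀ a ∈ s, ∀ b ∈ s, a ≠ b → (lt a b ∨ lt b a)
  lt_asymm : ∀ a b, lt a b → ¬ lt b a
  φ : V ≃ V
  φ_faces : ∀ s : Finset V, s.map φ.toEmbedding ∈ X.faces ↔ s ∈ X.faces
  φ_lt : ∀ a b, lt (φ a) (φ b) ↔ lt a b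

namespace OrderedComplex

/-- A simplicial isomorphism which preserves the orders and commutes with the automorphisms. -/
def Iso (Y Y' : OrderedComplex.{u}) : Prop :=
  ∃ e : Y.V ≃ Y'.V, (∀ s : Finset Y.V, s.map e.toEmbedding ∈ Y'.X.faces ↔ s ∈ Y.X.faces) ∧
    (∀ a b, Y'.lt (e a) (e b) ↔ Y.lt a b) ∧ ∀ a, e (Y.φ a) = Y'.φ (e a)

variable (Y : OrderedComplex.{u})

/-- The edges; each one is given by its two vertices `a < b`. -/
abbrev Edge : Type u := {p : Y.V × Y.V // Y.lt p.1 p.2}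

/-- The reflexive closure of `lt`. -/
def le (a b : Y.V) : Prop := a = b ∨ Y.lt a b

/-- Labelings of the edges by positive integers, additive on 2-simplices. -/
def IsLabeling (l : Y.Edge → ℕ+) : Prop :=
  ∀ (a b c : Y.V) (hab : Y.lt a b) (hbc : Y.lt b c) (hac : Y.lt a c),
    (∃ s ∈ Y.X.faces, a ∈ s ∧ b ∈ s ∧ c ∈ s) →
      l ⟨(a, b), hab⟩ + l ⟨(b, c), hbc⟩ = l ⟨(a, c), hac⟩

/-- The automorphism `φ` preserves the labels. -/
def IsInvariant (l : Y.Edge → ℕ+) : Prop :=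
  ∀ (a b : Y.V) (hab : Y.lt a b), l ⟨(Y.φ a, Y.φ b), (Y.φ_lt a b).2 hab⟩ = l ⟨(a, b), hab⟩

/-- The requirements on Garside flag complexes that do not involve labels. -/
structure IsUnlabeledGarside : Prop where
  flag : IsFlag Y.X
  simplyConnected : IsSimplyConnectedComplex Y.X
  le_iff : ∀ a b, Y.le a b ↔ Y.le b (Y.φ a)
  interval : ∀ x, IsLatticeRel
    (fun a b : {z : Y.V // Y.le x z ∧ Y.le z (Y.φ x)} => Y.le a.1 b.1)

/-- Garside flag complexes, except that `φ` need not preserve the labels. -/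
def IsNonequivariantGarsideFlag : Prop :=
  Y.IsUnlabeledGarside ∧ ∃ l : Y.Edge → ℕ+, Y.IsLabeling l

/-- Garside flag complexes: the automorphism `φ` preserves the labels. -/
def IsGarsideFlag : Prop :=
  Y.IsUnlabeledGarside ∧ ∃ l : Y.Edge → ℕ+, Y.IsLabeling l ∧ Y.IsInvariant l

end OrderedComplex

/-! ### The two constructions -/

namespace LatticePair

variable (A : LatticePair.{u})

/-- The category with objects the elements of `L`, with exactly one morphism from `x` to `y` if
`x ≤ y` and none otherwise, with the automorphism induced by `φ`; `Δ` at `x` is `x ≤ φ x`. -/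
def toCat : CatTriple.{u} where
  Obj := A.L
  cat := Preorder.smallCategory A.L
  φ := A.φ.monotone.functor
  φInv := A.φ.symm.monotone.functor
  φ_φInv := CategoryTheory.Functor.ext (fun x => A.φ.symm_apply_apply x)
    (fun _ _ _ => Subsingleton.elim _ _)
  φInv_φ := CategoryTheory.Functor.ext (fun x => A.φ.apply_symm_apply x)
    (fun _ _ _ => Subsingleton.elim _ _)
  Δ := { app := fun x => homOfLE (A.le_φ x)
         naturality := fun _ _ _ => Subsingleton.elim _ _ }

/-- The simplicial complex with vertices the elements of `L` and simplices the non-empty finite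
chains whose largest element is at most `φ` of the smallest one. -/
def complex : AbstractSimplicialComplex A.L where
  faces := {s | s.Nonempty ∧ IsChain (· ≤ ·) (s : Set A.L) ∧ ∀ a ∈ s, ∀ b ∈ s, b ≤ A.φ a}
  isRelLowerSet_faces := fun {_} hs => ⟨hs.1, fun _ hts ht =>
    ⟨ht, hs.2.1.mono (Finset.coe_subset.2 hts), fun a ha b hb => hs.2.2 a (hts ha) b (hts hb)⟩⟩
  singleton_mem := fun v => ⟨Finset.singleton_nonempty v, by simp, by simpa using A.le_φ v⟩

/-- The complex above with the order and the automorphism coming from `L`. -/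
def toComplex : OrderedComplex.{u} where
  V := A.L
  X := A.complex
  lt a b := a < b ∧ b ≤ A.φ a
  lt_adj := by
    classical
    rintro a b ⟨hab, hb⟩
    refine ⟨hab.ne, {a, b}, ⟨⟨a, by simp⟩, ?_, ?_⟩, by simp, by simp⟩
    · simpa using IsChain.pair hab.le
    · have h1 := A.le_φ a
      have h2 := A.le_φ b
      have h3 := hab.le.trans h2
      simp only [Finset.mem_insert, Finset.mem_singleton]
      rintro x (rfl | rfl) y (rfl | rfl) <;> assumption
  lt_trans := fun _ hs a ha _ _ c hc hab hbc => ⟨hab.1.trans hbc.1, hs.2.2 a ha c hc⟩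
  lt_total := fun s hs a ha b hb hab => by
    rcases hs.2.1 ha hb hab with h | h
    · exact Or.inl ⟨lt_of_le_of_ne h hab, hs.2.2 a ha b hb⟩
    · exact Or.inr ⟨lt_of_le_of_ne h hab.symm, hs.2.2 b hb a ha⟩
  lt_asymm := fun _ _ h h' => lt_asymm h.1 h'.1
  φ := A.φ.toEquiv
  φ_faces := fun s => by
    simp only [complex, IsChain, Set.Pairwise, Set.mem_ofPred_eq, Finset.map_nonempty,
      Finset.coe_map, Set.forall_mem_image, Finset.forall_mem_map]
    simp
  φ_lt := fun a b => by simp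

/-- The function on the morphisms of the category given by a function on comparable pairs. -/
def homLength (l : A.Pair → ℕ) : ∀ ⦃x y : A.toCat.Obj⦄, (x ⟶ y) → ℕ :=
  fun x y f => l ⟨(x, y), leOfHom (X := A.L) f⟩

/-- The labeling `m` of the edges of the complex is the restriction of the function `l`. -/
def RestrictsTo (l : A.Pair → ℕ) (m : A.toComplex.Edge → ℕ+) : Prop :=
  ∀ (a b : A.L) (h : A.toComplex.lt a b), l ⟨(a, b), h.1.le⟩ = (m ⟨(a, b), h⟩ : ℕ)

end LatticePair

end Garside

/-!
Everything is controlled by two observations: the order of a Garside lattice is the transitive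
closure of the relation `a ≤ b ≤ φ a`, and the sequence `v ⊓ φ^k x`, `k ∈ ℤ`, describes `v` in terms
of such short steps only.

**Lattices and categories.** A Garside lattice, seen as a category, has simple atoms
(`LatticePair.le_φ_of_covBy`), and its nerve is simply connected because it can be coned off from a
common lower bound of finitely many vertices (`EdgePath.exists_cone`). Conversely, in a thin
categorical Garside structure the objects form a poset in which the elements above, or below, a
given one form a lattice. Connectedness then gives common bounds of any two objects, so the poset is
a lattice (`CatTriple.IsConnectedSpecialGarside.isLatticeRel`), and factoring into atoms shows that
powers of `φ` are cofinal (`CatTriple.exists_hom_iterate`).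

**From lattices to complexes.** The complex of a Garside lattice is simply connected: an edge path
between `m` and `φ^k m` is contracted along the edge paths `m, x ⊓ φ m, x ⊓ φ² m, …, x`
(`LatticePair.cone_homotopic`). Hence a labeling is the coboundary of a function on the vertices
(`OrderedComplex.exists_potential`), which gives the length function that restricts to it; length
functions are determined by the edges since every `a ≤ b` factors into edges.

**From complexes to lattices.** This is the main part. The order is the transitive closure of the
relation on the edges; what has to be shown is that it is a lattice and that `a ≤ b ≤ φ a` holds
only for adjacent or equal `a`, `b`. The properties `m_k = m_{k+1} ⊓ φ(m_{k-1})` of the sequence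
`m_k = v ⊓ φ^k x` involve only meets in intervals `[z, φ z]`, so they make sense in the complex
before there is a global order. Sequences with these properties, the *normal sequences* from `x` to
`v`, are transported along edges from `v` to `w` by the recursion `m'_k = m'_{k+1} ⊓ φ(m_{k-1})`,
starting with `m'_k = w` for large `k`. The transport is compatible with triangles
(`isLift_of_isLift_of_isLift`), and bijective because going from `v` to `w` to `φ v` is the shift of
sequences composed with `φ`. So the normal sequences from `x` form a local system on a simply
connected complex, and the constant section through `x` extends to all vertices `v`
(`exists_isNormalFamily`). The term with index `0` of the sequence that it assigns to `v` is the
meet of `x` and `v`. Joins come from meets, as the upper bounds with the least potential.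
-/

namespace Garside

/-! ### Lattices from lattice relations -/

/-- The lattice structure with order relation `r`, joins and meets being chosen. -/
@[reducible]
noncomputable def IsLatticeRel.toLattice {α : Type*} {r : α → α → Prop} (h : IsLatticeRel r) :
    Lattice α where
  le := r
  le_refl := h.refl
  le_trans := h.trans
  le_antisymm := h.antisymm
  sup a b := (h.join a b).choose
  le_sup_left a b := (h.join a b).choose_spec.1
  le_sup_right a b := (h.join a b).choose_spec.2.1
  sup_le a b c := (h.join a b).choose_spec.2.2 c
  inf a b := (h.meet a b).choose
  inf_le_left a b := (h.meet a b).choose_spec.1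
  inf_le_right a b := (h.meet a b).choose_spec.2.1
  le_inf a b c := (h.meet b c).choose_spec.2.2 a

/-! ### Nerves of directed preorders -/

/-- Coning off: below `x` there is a vertex `m` such that prepending the edge from any vertex
`m' ≤ m` makes every edge path starting at `x` homotopic to a single edge. -/
theorem EdgePath.exists_cone {L : Type u} [Lattice L] {x y : Vertex (nerve L)}
    (p : EdgePath (nerve L) x y) :
    ∃ m : Vertex (nerve L), nerveEquiv m ≤ nerveEquiv x ∧
      ∀ m' : Vertex (nerve L), nerveEquiv m' ≤ nerveEquiv m →
        ∀ (e : SSet.Edge m' x) (e' : SSet.Edge m' y),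
          (EdgePath.fwd e p).Homotopic (.fwd e' (.nil y)) := by
  have thin : ∀ {a b : Vertex (nerve L)} (e e' : SSet.Edge a b), e = e' := fun e e' =>
    nerve.homEquiv.injective (Subsingleton.elim _ _)
  have tri : ∀ {a b c : Vertex (nerve L)} (e : SSet.Edge a b) (f : SSet.Edge b c)
      (g : SSet.Edge a c), Nonempty (SSet.Edge.CompStruct e f g) := by
    intro a b c e f g
    obtain ⟨a, rfl⟩ := nerveEquiv.symm.surjective a
    obtain ⟨b, rfl⟩ := nerveEquiv.symm.surjective b
    obtain ⟨c, rfl⟩ := nerveEquiv.symm.surjective c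
    obtain ⟨e, rfl⟩ := nerve.edgeMk_surjective e
    obtain ⟨f, rfl⟩ := nerve.edgeMk_surjective f
    obtain ⟨g, rfl⟩ := nerve.edgeMk_surjective g
    exact (nerve.nonempty_compStruct_iff e f g).2 (Subsingleton.elim _ _)
  induction p with
  | nil x =>
    exact ⟨x, le_rfl, fun m' _ e e' => thin e e' ▸ .refl _⟩
  | @fwd x y z f p ih =>
    obtain ⟨m, -, hm⟩ := ih
    refine ⟨nerveEquiv.symm (nerveEquiv m ⊓ nerveEquiv x), inf_le_right, fun m' hm' e e' => ?_⟩
    have hx : nerveEquiv x ≤ nerveEquiv y := leOfHom (nerve.homEquiv f)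
    have g : SSet.Edge m' y := nerve.homEquiv.symm (homOfLE ((hm'.trans inf_le_right).trans hx))
    exact (EdgePath.Homotopic.triangle (tri e f g).some p).trans
      (hm m' (hm'.trans inf_le_left) g e')
  | @bwd x y z f p ih =>
    obtain ⟨m, hmy, hm⟩ := ih
    have hx : nerveEquiv y ≤ nerveEquiv x := leOfHom (nerve.homEquiv f)
    refine ⟨m, hmy.trans hx, fun m' hm' e e' => ?_⟩
    have g : SSet.Edge m' y := nerve.homEquiv.symm (homOfLE (hm'.trans hmy))
    exact ((EdgePath.Homotopic.triangle (tri g f e).some (.bwd f p)).symm.trans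
      (.fwd_congr g (.fwd_bwd f p))).trans (hm m' hm' g e')

theorem isSimplyConnectedSSet_nerve (L : Type u) [Lattice L] [Nonempty L] :
    IsSimplyConnectedSSet (nerve L) where
  nonempty := ⟨nerveEquiv.symm (Classical.arbitrary L)⟩
  connected x y := by
    let m : Vertex (nerve L) := nerveEquiv.symm (nerveEquiv x ⊓ nerveEquiv y)
    let e : SSet.Edge m x := nerve.homEquiv.symm (homOfLE inf_le_left)
    let f : SSet.Edge m y := nerve.homEquiv.symm (homOfLE inf_le_right)
    exact ⟨.bwd e (.fwd f (.nil y))⟩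
  null_homotopic x p := by
    obtain ⟨m, hmx, hm⟩ := p.exists_cone
    let e : SSet.Edge m x := nerve.homEquiv.symm (homOfLE hmx)
    exact ((EdgePath.Homotopic.bwd_fwd e p).symm.trans
      (.bwd_congr e (hm m le_rfl e e))).trans (.bwd_fwd e _)

/-! ### From Garside lattices to categorical Garside structures -/

namespace LatticePair

variable {A A' : LatticePair.{u}}

theorem φ_le_iterate_succ (A : LatticePair.{u}) (k : ℕ) (x : A.L) : A.φ x ≤ A.φ^[k + 1] x := by
  rw [Function.iterate_succ_apply]
  induction k with
  | zero => exact le_rfl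
  | succ k ih =>
    rw [Function.iterate_succ_apply']
    exact ih.trans (A.le_φ _)

/-- A cover `x ⋖ y` satisfies `y ≤ φ x`: otherwise `y ⊓ φ x = x`, so that `φ y = y ⊔ φ x` because
`φ x ⋖ φ y`, and then `y ≤ φ^(k+1) x` implies `y ≤ φ^k x`, for all `k`. -/
theorem le_φ_of_covBy (hA : A.IsGarside) {x y : A.L} (h : x ⋖ y) : y ≤ A.φ x := by
  by_contra hy
  have hinf : y ⊓ A.φ x = x := by
    rcases h.eq_or_eq (le_inf h.le (A.le_φ x)) inf_le_left with h' | h'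
    · exact h'
    · exact absurd (inf_eq_left.1 h') hy
  have hcov : A.φ x ⋖ A.φ y := (apply_covBy_apply_iff A.φ).2 h
  have hsup : y ⊔ A.φ x = A.φ y := by
    rcases hcov.eq_or_eq le_sup_right (sup_le (A.le_φ y) hcov.le) with h' | h'
    · exact absurd (sup_eq_right.1 h') hy
    · exact h'
  have key : ∀ k : ℕ, ¬ y ≤ A.φ^[k] x := by
    intro k
    induction k with
    | zero => exact fun h' => absurd h' h.lt.not_ge
    | succ k ih =>
      intro h'
      apply ih
      have h2 : A.φ y ≤ A.φ^[k + 1] x := hsup ▸ sup_le h' (A.φ_le_iterate_succ k x)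
      rw [Function.iterate_succ_apply'] at h2
      exact A.φ.le_iff_le.1 h2
  obtain ⟨k, hk⟩ := hA.cofinal y x
  exact key k hk

instance (x y : A.toCat.Obj) : Subsingleton (x ⟶ y) := ⟨fun ⟨⟨_⟩⟩ ⟨⟨_⟩⟩ => rfl⟩

theorem toCat_thin {x y : A.toCat.Obj} (f g : x ⟶ y) : f = g := Subsingleton.elim f g

/-- The morphism of the category of a lattice given by an inequality. -/
def toCatHom {x y : A.L} (h : x ≤ y) : @Quiver.Hom A.toCat.Obj _ x y := @homOfLE A.L _ x y h

theorem toCat_nonempty_hom {x y : A.toCat.Obj} : Nonempty (x ⟶ y) ↔ @LE.le A.L _ x y :=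
  ⟨fun ⟨f⟩ => leOfHom (X := A.L) f, fun h => ⟨toCatHom h⟩⟩

theorem isUnitMor_toCat {x y : A.toCat.Obj} (f : x ⟶ y) : A.toCat.IsUnitMor f ↔ x = y :=
  ⟨fun h => h.1, fun h => ⟨h, Subsingleton.elim _ _⟩⟩

theorem leftDvd_toCat {x : A.toCat.Obj} (f g : Σ y : A.toCat.Obj, x ⟶ y) :
    A.toCat.LeftDvd x f g ↔ @LE.le A.L _ f.1 g.1 :=
  ⟨fun ⟨h, _⟩ => toCat_nonempty_hom.1 ⟨h⟩,
    fun h => (toCat_nonempty_hom.2 h).elim fun k => ⟨k, Subsingleton.elim _ _⟩⟩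

theorem rightDvd_toCat {x : A.toCat.Obj} (f g : Σ y : A.toCat.Obj, y ⟶ x) :
    A.toCat.RightDvd x f g ↔ @LE.le A.L _ g.1 f.1 :=
  ⟨fun ⟨h, _⟩ => toCat_nonempty_hom.1 ⟨h⟩,
    fun h => (toCat_nonempty_hom.2 h).elim fun k => ⟨k, Subsingleton.elim _ _⟩⟩

theorem isLatticeRel_leftDvd_toCat (x : A.toCat.Obj) : IsLatticeRel (A.toCat.LeftDvd x) := by
  have up : ∀ f : Σ y : A.toCat.Obj, x ⟶ y, @LE.le A.L _ x f.1 :=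
    fun f => toCat_nonempty_hom.1 ⟨f.2⟩
  refine ⟨?_, ?_, ?_, ?_, ?_⟩ <;> simp only [leftDvd_toCat]
  · exact fun f => le_rfl
  · rintro ⟨a, f⟩ ⟨b, g⟩ h h'
    obtain rfl : a = b := le_antisymm (α := A.L) h h'
    rw [Subsingleton.elim f g]
  · exact fun f g k h h' => le_trans h h'
  · exact fun f g => ⟨⟨max (α := A.L) f.1 g.1, toCatHom (le_sup_of_le_left (up f))⟩,
      le_sup_left (α := A.L), le_sup_right (α := A.L), fun k h h' => sup_le (α := A.L) h h'⟩
  · exact fun f g => ⟨⟨min (α := A.L) f.1 g.1, toCatHom (le_inf (up f) (up g))⟩,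
      inf_le_left (α := A.L), inf_le_right (α := A.L), fun k h h' => le_inf (α := A.L) h h'⟩

theorem isLatticeRel_rightDvd_toCat (x : A.toCat.Obj) : IsLatticeRel (A.toCat.RightDvd x) := by
  have dn : ∀ f : Σ y : A.toCat.Obj, y ⟶ x, @LE.le A.L _ f.1 x :=
    fun f => toCat_nonempty_hom.1 ⟨f.2⟩
  refine ⟨?_, ?_, ?_, ?_, ?_⟩ <;> simp only [rightDvd_toCat]
  · exact fun f => le_rfl
  · rintro ⟨a, f⟩ ⟨b, g⟩ h h'
    obtain rfl : a = b := le_antisymm (α := A.L) h' h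
    rw [Subsingleton.elim f g]
  · exact fun f g k h h' => le_trans h' h
  · exact fun f g => ⟨⟨min (α := A.L) f.1 g.1, toCatHom (inf_le_of_left_le (dn f))⟩,
      inf_le_left (α := A.L), inf_le_right (α := A.L), fun k h h' => le_inf (α := A.L) h h'⟩
  · exact fun f g => ⟨⟨max (α := A.L) f.1 g.1, toCatHom (sup_le (dn f) (dn g))⟩,
      le_sup_left (α := A.L), le_sup_right (α := A.L), fun k h h' => sup_le (α := A.L) h h'⟩

theorem isLength_homLength_iff (l : A.Pair → ℕ) :
    A.IsLength l ↔ A.toCat.IsLength (A.homLength l) := by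
  constructor
  · exact fun h => ⟨fun x y z f g => h.add x y z _ _,
      fun x y f => (h.eq_zero_iff _).trans (isUnitMor_toCat f).symm⟩
  · exact fun h => ⟨fun _ _ _ hab hbc => h.comp (toCatHom hab) (toCatHom hbc),
      fun p => (h.eq_zero_iff (x := p.1.1) (y := p.1.2) (toCatHom p.2)).trans (isUnitMor_toCat _)⟩

theorem isInvariant_homLength_iff (l : A.Pair → ℕ) :
    A.IsInvariant l ↔ A.toCat.IsInvariant (A.homLength l) :=
  ⟨fun h x y f => h x y (leOfHom (X := A.L) f), fun h _ _ hab => h (toCatHom hab)⟩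

theorem IsGarside.isConnectedSpecialGarside (hA : A.IsGarside) :
    A.toCat.IsConnectedSpecialGarside := by
  have : Nonempty A.L := hA.nonempty
  refine ⟨IsFiltered.isConnected A.L, ⟨?_, ?_, ?_, ?_, ?_⟩, ⟨?_, ?_⟩⟩
  · obtain ⟨l, hl⟩ := hA.homogeneous
    exact ⟨A.homLength l, (isLength_homLength_iff l).1 hl⟩
  · exact fun _ _ _ _ _ _ _ _ _ => Subsingleton.elim _ _
  · intro x y f hf
    have hxy : @LE.le A.L _ x y := toCat_nonempty_hom.1 ⟨f⟩
    have hne : x ≠ y := fun h => hf.1 ((isUnitMor_toCat f).2 h)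
    have hcov : @CovBy A.L _ x y := by
      refine ⟨lt_of_le_of_ne hxy hne, fun z hxz hzy => ?_⟩
      rcases hf.2 z (toCatHom hxz.le) (toCatHom hzy.le)
        (Subsingleton.elim _ _) with h | h
      · exact hxz.ne ((isUnitMor_toCat _).1 h)
      · exact hzy.ne ((isUnitMor_toCat _).1 h)
    exact ⟨toCatHom (le_φ_of_covBy hA hcov), Subsingleton.elim _ _⟩
  · exact isLatticeRel_leftDvd_toCat
  · exact isLatticeRel_rightDvd_toCat
  · exact fun _ _ _ _ => Subsingleton.elim _ _
  · exact isSimplyConnectedSSet_nerve A.L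

theorem IsEquivariantGarside.isEquivariantConnectedSpecialGarside
    (hA : A.IsEquivariantGarside) : A.toCat.IsEquivariantConnectedSpecialGarside :=
  let ⟨l, hl, hi⟩ := hA.2
  ⟨hA.1.isConnectedSpecialGarside, A.homLength l, (isLength_homLength_iff l).1 hl,
    (isInvariant_homLength_iff l).1 hi⟩

theorem iso_iff_toCat_iso : A.Iso A' ↔ A.toCat.Iso A'.toCat := by
  constructor
  · rintro ⟨e, he⟩
    refine ⟨e.monotone.functor, e.symm.monotone.functor,
      CategoryTheory.Functor.ext (fun x => e.symm_apply_apply x)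
        (fun _ _ _ => Subsingleton.elim _ _),
      CategoryTheory.Functor.ext (fun x => e.apply_symm_apply x)
        (fun _ _ _ => Subsingleton.elim _ _),
      CategoryTheory.Functor.ext (fun x => he x) (fun _ _ _ => Subsingleton.elim _ _), fun x => ?_⟩
    apply Subsingleton.helim
    exact congrArg (fun z => @Quiver.Hom A'.toCat.Obj _ (e x) z) (he x)
  · rintro ⟨F, G, hFG, hGF, hφ, -⟩
    have mono : ∀ {x y : A.L}, x ≤ y → @LE.le A'.L _ (F.obj x) (F.obj y) :=
      fun h => toCat_nonempty_hom.1 ⟨F.map (toCatHom h)⟩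
    have mono' : ∀ {x y : A'.L}, x ≤ y → @LE.le A.L _ (G.obj x) (G.obj y) :=
      fun h => toCat_nonempty_hom.1 ⟨G.map (toCatHom h)⟩
    have left : ∀ x, G.obj (F.obj x) = x := fun x => congrArg (fun H => H.obj x) hFG
    have right : ∀ x, F.obj (G.obj x) = x := fun x => congrArg (fun H => H.obj x) hGF
    refine ⟨⟨⟨F.obj, G.obj, left, right⟩, fun {x y} => ⟨fun h => ?_, mono⟩⟩,
      fun x => congrArg (fun H => H.obj x) hφ⟩
    have h' := mono' h
    erw [left, left] at h'
    exact h'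

end LatticePair

/-! ### From categorical Garside structures to Garside lattices -/

namespace CatTriple

variable {T : CatTriple.{u}}

theorem eq_of_hom_of_hom (hT : T.IsGarside) (hS : T.IsSpecial) {x y : T.Obj} (f : x ⟶ y)
    (g : y ⟶ x) : x = y := by
  obtain ⟨l, hl⟩ := hT.homogeneous
  have h := hl.comp f g
  rw [hS.thin (f ≫ g) (𝟙 x), (hl.eq_zero_iff (𝟙 x)).2 ⟨rfl, rfl⟩] at h
  exact ((hl.eq_zero_iff f).1 (by omega)).1

/-- Along a zigzag of morphisms, the join of two morphisms with a common target provides a common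
source. -/
theorem exists_common_source (hc : IsConnected T.Obj) (hT : T.IsGarside) (x y : T.Obj) :
    ∃ z : T.Obj, Nonempty (z ⟶ x) ∧ Nonempty (z ⟶ y) := by
  induction isPreconnected_zigzag x y with
  | refl => exact ⟨x, ⟨𝟙 x⟩, ⟨𝟙 x⟩⟩
  | @tail y w _ hyw ih =>
    obtain ⟨z, hzx, ⟨f⟩⟩ := ih
    rcases hyw with ⟨⟨g⟩⟩ | ⟨⟨g⟩⟩
    · exact ⟨z, hzx, ⟨f ≫ g⟩⟩
    · obtain ⟨⟨j, k⟩, ⟨a, -⟩, ⟨b, -⟩, -⟩ := (hT.lattice_to y).join ⟨z, f⟩ ⟨w, g⟩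
      exact ⟨j, ⟨a ≫ hzx.some⟩, ⟨b⟩⟩

theorem exists_common_target (hc : IsConnected T.Obj) (hT : T.IsGarside) (x y : T.Obj) :
    ∃ z : T.Obj, Nonempty (x ⟶ z) ∧ Nonempty (y ⟶ z) := by
  obtain ⟨z, ⟨f⟩, ⟨g⟩⟩ := exists_common_source hc hT x y
  obtain ⟨⟨j, k⟩, ⟨a, -⟩, ⟨b, -⟩, -⟩ := (hT.lattice_from z).join ⟨x, f⟩ ⟨y, g⟩
  exact ⟨j, ⟨a⟩, ⟨b⟩⟩

/-- A least upper bound among the objects above one common lower bound is a least upper bound among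
all objects, and dually. -/
theorem IsConnectedSpecialGarside.isLatticeRel (hT : T.IsConnectedSpecialGarside) :
    IsLatticeRel (fun x y : T.Obj => Nonempty (x ⟶ y)) := by
  obtain ⟨hc, hG, hS⟩ := hT
  refine ⟨fun x => ⟨𝟙 x⟩, fun x y ⟨f⟩ ⟨g⟩ => eq_of_hom_of_hom hG hS f g,
    fun x y z ⟨f⟩ ⟨g⟩ => ⟨f ≫ g⟩, fun x y => ?_, fun x y => ?_⟩
  · obtain ⟨z, ⟨f⟩, ⟨g⟩⟩ := exists_common_source hc hG x y
    obtain ⟨⟨j, k⟩, ⟨a, -⟩, ⟨b, -⟩, hj⟩ := (hG.lattice_from z).join ⟨x, f⟩ ⟨y, g⟩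
    refine ⟨j, ⟨a⟩, ⟨b⟩, fun c ⟨p⟩ ⟨q⟩ => ?_⟩
    obtain ⟨r, -⟩ := hj ⟨c, f ≫ p⟩ ⟨p, rfl⟩ ⟨q, hS.thin _ _⟩
    exact ⟨r⟩
  · obtain ⟨z, ⟨f⟩, ⟨g⟩⟩ := exists_common_target hc hG x y
    obtain ⟨⟨j, k⟩, ⟨a, -⟩, ⟨b, -⟩, hj⟩ := (hG.lattice_to z).join ⟨x, f⟩ ⟨y, g⟩
    refine ⟨j, ⟨a⟩, ⟨b⟩, fun c ⟨p⟩ ⟨q⟩ => ?_⟩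
    obtain ⟨r, -⟩ := hj ⟨c, p ≫ f⟩ ⟨p, rfl⟩ ⟨q, hS.thin _ _⟩
    exact ⟨r⟩

/-- Factoring a morphism `x ⟶ y` into atoms, each of which is simple, bounds `y` by a power of `φ`
applied to `x`. -/
theorem exists_hom_iterate (hT : T.IsGarside) {x y : T.Obj} (f : x ⟶ y) :
    ∃ k : ℕ, Nonempty (y ⟶ T.φ.obj^[k] x) := by
  obtain ⟨l, hl⟩ := hT.homogeneous
  have mono : ∀ (k : ℕ) {a b : T.Obj}, (a ⟶ b) →
      Nonempty (T.φ.obj^[k] a ⟶ T.φ.obj^[k] b) := by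
    intro k
    induction k with
    | zero => exact fun f => ⟨f⟩
    | succ k ih => exact fun f => by simpa only [Function.iterate_succ_apply] using ih (T.φ.map f)
  induction hn : l f using Nat.strong_induction_on generalizing x y with
  | _ n ih =>
    subst hn
    by_cases hu : T.IsUnitMor f
    · obtain ⟨rfl, -⟩ := hu
      exact ⟨0, ⟨𝟙 x⟩⟩
    by_cases ha : T.IsAtom f
    · obtain ⟨g, -⟩ := hT.simple_of_atom f ha
      exact ⟨1, ⟨g⟩⟩
    simp only [IsAtom, hu, not_false_eq_true, true_and, not_forall, not_or] at ha
    obtain ⟨z, g, h, rfl, hg, hh⟩ := ha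
    have hg' := mt (hl.eq_zero_iff g).1 hg
    have hh' := mt (hl.eq_zero_iff h).1 hh
    have hgh := hl.comp g h
    obtain ⟨i, ⟨p⟩⟩ := ih (l g) (by omega) g rfl
    obtain ⟨j, ⟨q⟩⟩ := ih (l h) (by omega) h rfl
    obtain ⟨r⟩ := mono j p
    exact ⟨j + i, ⟨by rw [Function.iterate_add_apply]; exact q ≫ r⟩⟩

/-- The objects of a connected special categorical Garside structure, ordered by the existence of
morphisms. -/
noncomputable def toLatticePair (T : CatTriple.{u}) (hT : T.IsConnectedSpecialGarside) :
    LatticePair.{u} where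
  L := T.Obj
  lat := hT.isLatticeRel.toLattice
  φ :=
    letI := hT.isLatticeRel.toLattice
    { toFun := T.φ.obj
      invFun := T.φInv.obj
      left_inv := fun x => congrArg (fun H => H.obj x) T.φ_φInv
      right_inv := fun x => congrArg (fun H => H.obj x) T.φInv_φ
      map_rel_iff' := fun {x y} => ⟨fun ⟨f⟩ => ⟨by
        have h : ∀ z, T.φInv.obj (T.φ.obj z) = z := fun z => congrArg (fun H => H.obj z) T.φ_φInv
        simpa only [Equiv.coe_fn_mk, h] using T.φInv.map f⟩, fun ⟨f⟩ => ⟨T.φ.map f⟩⟩ }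
  le_φ x := ⟨T.Δ.app x⟩

/-- The length function on comparable pairs given by one on morphisms. -/
noncomputable def pairLength (hT : T.IsConnectedSpecialGarside)
    (l : ∀ ⦃x y : T.Obj⦄, (x ⟶ y) → ℕ) : (T.toLatticePair hT).Pair → ℕ :=
  fun p => l (Nonempty.some (α := @Quiver.Hom T.Obj _ p.1.1 p.1.2) p.2)

theorem pairLength_mk (hT : T.IsConnectedSpecialGarside) (l : ∀ ⦃x y : T.Obj⦄, (x ⟶ y) → ℕ)
    {x y : T.Obj} (f : x ⟶ y) : pairLength hT l ⟨(x, y), ⟨f⟩⟩ = l f :=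
  congrArg (fun g => l g) (hT.2.2.thin _ _)

theorem IsLength.pairLength (hT : T.IsConnectedSpecialGarside)
    {l : ∀ ⦃x y : T.Obj⦄, (x ⟶ y) → ℕ} (hl : T.IsLength l) :
    (T.toLatticePair hT).IsLength (pairLength hT l) where
  add := by
    rintro a b c ⟨f⟩ ⟨g⟩
    exact ((pairLength_mk hT l (f ≫ g)).trans (hl.comp f g)).trans
      (congrArg₂ (· + ·) (pairLength_mk hT l f).symm (pairLength_mk hT l g).symm)
  eq_zero_iff := by
    rintro ⟨⟨a, b⟩, ⟨f⟩⟩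
    refine (Eq.congr_left (pairLength_mk hT l f)).trans ((hl.eq_zero_iff f).trans
      ⟨fun h => h.1, fun h => ⟨h, hT.2.2.thin _ _⟩⟩)

theorem IsInvariant.pairLength (hT : T.IsConnectedSpecialGarside)
    {l : ∀ ⦃x y : T.Obj⦄, (x ⟶ y) → ℕ} (hl : T.IsInvariant l) :
    (T.toLatticePair hT).IsInvariant (pairLength hT l) := by
  rintro a b ⟨f⟩
  exact ((pairLength_mk hT l (T.φ.map f)).trans (hl f)).trans (pairLength_mk hT l f).symm

theorem isGarside_toLatticePair (hT : T.IsConnectedSpecialGarside) :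
    (T.toLatticePair hT).IsGarside where
  nonempty := hT.1.is_nonempty
  homogeneous :=
    let ⟨_, hl⟩ := hT.2.1.homogeneous
    ⟨_, hl.pairLength hT⟩
  cofinal x y := by
    obtain ⟨z, ⟨f⟩, ⟨g⟩⟩ := exists_common_target hT.1 hT.2.1 x y
    obtain ⟨k, ⟨h⟩⟩ := exists_hom_iterate hT.2.1 g
    exact ⟨k, ⟨f ≫ h⟩⟩

theorem toCat_toLatticePair_iso (hT : T.IsConnectedSpecialGarside) :
    (T.toLatticePair hT).toCat.Iso T := by
  let F : (T.toLatticePair hT).toCat.Obj ⥤ T.Obj :=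
    { obj := fun x => x
      map := fun {x y} f => Nonempty.some (α := @Quiver.Hom T.Obj _ x y)
        (LatticePair.toCat_nonempty_hom.1 ⟨f⟩)
      map_id := fun _ => hT.2.2.thin _ _
      map_comp := fun _ _ => hT.2.2.thin _ _ }
  let G : T.Obj ⥤ (T.toLatticePair hT).toCat.Obj :=
    { obj := fun x => x
      map := fun f => LatticePair.toCatHom (A := T.toLatticePair hT) ⟨f⟩
      map_id := fun _ => LatticePair.toCat_thin (A := T.toLatticePair hT) _ _
      map_comp := fun _ _ => LatticePair.toCat_thin (A := T.toLatticePair hT) _ _ }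
  exact ⟨F, G, CategoryTheory.Functor.ext (fun _ => rfl) (fun _ _ _ => Subsingleton.elim _ _),
    CategoryTheory.Functor.ext (fun _ => rfl) (fun _ _ _ => hT.2.2.thin _ _),
    CategoryTheory.Functor.ext (fun _ => rfl) (fun _ _ _ => hT.2.2.thin _ _),
    fun x => heq_of_eq (hT.2.2.thin _ _)⟩

end CatTriple

theorem bijection_toCat : BijectionUpToIso LatticePair.Iso.{u} CatTriple.Iso.{u}
    LatticePair.IsGarside CatTriple.IsConnectedSpecialGarside LatticePair.toCat where
  maps_to _ hA := hA.isConnectedSpecialGarside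
  iso_iff _ _ _ _ := LatticePair.iso_iff_toCat_iso
  surjective T hT := ⟨T.toLatticePair hT, CatTriple.isGarside_toLatticePair hT,
    CatTriple.toCat_toLatticePair_iso hT⟩

theorem bijection_toCat_equivariant : BijectionUpToIso LatticePair.Iso.{u} CatTriple.Iso.{u}
    LatticePair.IsEquivariantGarside CatTriple.IsEquivariantConnectedSpecialGarside
    LatticePair.toCat where
  maps_to _ hA := hA.isEquivariantConnectedSpecialGarside
  iso_iff _ _ _ _ := LatticePair.iso_iff_toCat_iso
  surjective T hT :=
    let ⟨_, hl, hi⟩ := hT.2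
    ⟨T.toLatticePair hT.1, ⟨CatTriple.isGarside_toLatticePair hT.1, _, hl.pairLength hT.1,
      hi.pairLength hT.1⟩, CatTriple.toCat_toLatticePair_iso hT.1⟩

/-! ### Local systems on simply connected ordered complexes -/

namespace OrderedComplex

variable {Y : OrderedComplex.{u}}

theorem lt_or_lt_of_adj {a b : Y.V} (h : (oneSkeleton Y.X).Adj a b) : Y.lt a b ∨ Y.lt b a :=
  let ⟨hne, s, hs, ha, hb⟩ := h
  Y.lt_total s hs a ha b hb hne

theorem adj_iff {a b : Y.V} : (oneSkeleton Y.X).Adj a b ↔ Y.lt a b ∨ Y.lt b a :=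
  ⟨lt_or_lt_of_adj, fun h => h.elim (Y.lt_adj a b) fun h => (Y.lt_adj b a h).symm⟩

/-- A local system on an ordered complex: a family of sets indexed by the vertices, with bijections
along the edges that are compatible on the 2-simplices. -/
structure LocalSystem (Y : OrderedComplex.{u}) (F : Y.V → Type*) where
  map : ∀ {a b : Y.V}, Y.lt a b → F a ≃ F b
  map_map : ∀ {a b c : Y.V} (hab : Y.lt a b) (hbc : Y.lt b c) (hac : Y.lt a c),
    (∃ s ∈ Y.X.faces, a ∈ s ∧ b ∈ s ∧ c ∈ s) → ∀ s, map hbc (map hab s) = map hac s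

namespace LocalSystem

variable {F : Y.V → Type*} (S : LocalSystem Y F)

open Classical in
/-- The bijection along an edge that is traversed in any direction. -/
noncomputable def adjMap {a b : Y.V} (h : (oneSkeleton Y.X).Adj a b) : F a ≃ F b :=
  if hab : Y.lt a b then S.map hab else (S.map ((lt_or_lt_of_adj h).resolve_left hab)).symm

theorem adjMap_of_lt {a b : Y.V} (h : (oneSkeleton Y.X).Adj a b) (hab : Y.lt a b) :
    S.adjMap h = S.map hab := dif_pos hab

theorem adjMap_of_gt {a b : Y.V} (h : (oneSkeleton Y.X).Adj a b) (hba : Y.lt b a) :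
    S.adjMap h = (S.map hba).symm := dif_neg (Y.lt_asymm _ _ hba)

theorem adjMap_symm {a b : Y.V} (h : (oneSkeleton Y.X).Adj a b) (h' : (oneSkeleton Y.X).Adj b a)
    (s : F a) : S.adjMap h' (S.adjMap h s) = s := by
  rcases lt_or_lt_of_adj h with hab | hba
  · rw [S.adjMap_of_lt h hab, S.adjMap_of_gt h' hab, Equiv.symm_apply_apply]
  · rw [S.adjMap_of_gt h hba, S.adjMap_of_lt h' hba, Equiv.apply_symm_apply]

theorem adjMap_adjMap {a b c : Y.V} (hab : (oneSkeleton Y.X).Adj a b)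
    (hbc : (oneSkeleton Y.X).Adj b c) (hac : (oneSkeleton Y.X).Adj a c)
    (hs : ∃ s ∈ Y.X.faces, a ∈ s ∧ b ∈ s ∧ c ∈ s) (s : F a) :
    S.adjMap hbc (S.adjMap hab s) = S.adjMap hac s := by
  obtain ⟨t, ht, ha, hb, hc⟩ := hs
  have acb : ∃ s ∈ Y.X.faces, a ∈ s ∧ c ∈ s ∧ b ∈ s := ⟨t, ht, ha, hc, hb⟩
  have bac : ∃ s ∈ Y.X.faces, b ∈ s ∧ a ∈ s ∧ c ∈ s := ⟨t, ht, hb, ha, hc⟩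
  have bca : ∃ s ∈ Y.X.faces, b ∈ s ∧ c ∈ s ∧ a ∈ s := ⟨t, ht, hb, hc, ha⟩
  have cab : ∃ s ∈ Y.X.faces, c ∈ s ∧ a ∈ s ∧ b ∈ s := ⟨t, ht, hc, ha, hb⟩
  have cba : ∃ s ∈ Y.X.faces, c ∈ s ∧ b ∈ s ∧ a ∈ s := ⟨t, ht, hc, hb, ha⟩
  rcases lt_or_lt_of_adj hab with h1 | h1 <;> rcases lt_or_lt_of_adj hbc with h2 | h2 <;>
    rcases lt_or_lt_of_adj hac with h3 | h3
  · rw [S.adjMap_of_lt _ h1, S.adjMap_of_lt _ h2, S.adjMap_of_lt _ h3]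
    exact S.map_map h1 h2 h3 ⟨t, ht, ha, hb, hc⟩ s
  · exact absurd (Y.lt_trans t ht a ha b hb c hc h1 h2) (Y.lt_asymm _ _ h3)
  · rw [S.adjMap_of_lt _ h1, S.adjMap_of_gt _ h2, S.adjMap_of_lt _ h3, Equiv.symm_apply_eq]
    exact (S.map_map h3 h2 h1 acb s).symm
  · rw [S.adjMap_of_lt _ h1, S.adjMap_of_gt _ h2, S.adjMap_of_gt _ h3, Equiv.symm_apply_eq,
      ← S.map_map h3 h1 h2 cab, Equiv.apply_symm_apply]
  · rw [S.adjMap_of_gt _ h1, S.adjMap_of_lt _ h2, S.adjMap_of_lt _ h3,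
      ← S.map_map h1 h3 h2 bac, Equiv.apply_symm_apply]
  · rw [S.adjMap_of_gt _ h1, S.adjMap_of_lt _ h2, S.adjMap_of_gt _ h3, Equiv.eq_symm_apply,
      S.map_map h2 h3 h1 bca, Equiv.apply_symm_apply]
  · exact absurd (Y.lt_trans t ht c hc b hb a ha h2 h1) (Y.lt_asymm _ _ h3)
  · rw [S.adjMap_of_gt _ h1, S.adjMap_of_gt _ h2, S.adjMap_of_gt _ h3, Equiv.eq_symm_apply,
      ← S.map_map h2 h1 h3 cba, Equiv.apply_symm_apply, Equiv.apply_symm_apply]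

/-- Transport along an edge path. -/
noncomputable def transport : ∀ {a b : Y.V}, (oneSkeleton Y.X).Walk a b → F a → F b
  | _, _, .nil, s => s
  | _, _, .cons h p, s => transport p (S.adjMap h s)

@[simp]
theorem transport_nil {a : Y.V} (s : F a) :
    S.transport (.nil : (oneSkeleton Y.X).Walk a a) s = s := rfl

@[simp]
theorem transport_cons {a b c : Y.V} (h : (oneSkeleton Y.X).Adj a b)
    (p : (oneSkeleton Y.X).Walk b c) (s : F a) :
    S.transport (.cons h p) s = S.transport p (S.adjMap h s) := rfl

theorem transport_append {a b c : Y.V} (p : (oneSkeleton Y.X).Walk a b)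
    (q : (oneSkeleton Y.X).Walk b c) (s : F a) :
    S.transport (p.append q) s = S.transport q (S.transport p s) := by
  induction p with
  | nil => rfl
  | cons h p ih => exact ih q _

theorem transport_eq_of_homotopic {a b : Y.V} {p q : (oneSkeleton Y.X).Walk a b}
    (h : WalkHomotopic Y.X p q) (s : F a) : S.transport p s = S.transport q s := by
  induction h with
  | refl => rfl
  | symm _ ih => exact (ih s).symm
  | trans _ _ ih ih' => exact (ih s).trans (ih' s)
  | cons_congr h _ ih => exact ih _
  | backtrack h h' p => simp only [transport_cons, S.adjMap_symm]
  | triangle hab hbc hac hs p => simp only [transport_cons, S.adjMap_adjMap hab hbc hac hs]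

/-- On a simply connected complex, a local system has a global section through any point. -/
theorem exists_section (hY : IsSimplyConnectedComplex Y.X) (x : Y.V) (s : F x) :
    ∃ t : ∀ v, F v, t x = s ∧ ∀ {a b : Y.V} (h : Y.lt a b), S.map h (t a) = t b := by
  have loop : ∀ {a : Y.V} (p : (oneSkeleton Y.X).Walk a a) (s : F a), S.transport p s = s :=
    fun p s => S.transport_eq_of_homotopic (hY.null_homotopic _ p) s
  have path : ∀ {a b : Y.V} (p q : (oneSkeleton Y.X).Walk a b) (s : F a),
      S.transport p s = S.transport q s := by
    intro a b p q s
    obtain ⟨r⟩ := hY.connected.preconnected b a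
    have h : S.transport r (S.transport p s) = s := by rw [← S.transport_append, loop]
    rw [← loop (r.append q) (S.transport p s), S.transport_append, h]
  let w : ∀ v, (oneSkeleton Y.X).Walk x v := fun v => (hY.connected.preconnected x v).some
  refine ⟨fun v => S.transport (w v) s, loop _ _, fun {a b} h => ?_⟩
  change S.map h (S.transport (w a) s) = S.transport (w b) s
  rw [← path ((w a).append (.cons (Y.lt_adj a b h) .nil)) (w b), S.transport_append,
    transport_cons, transport_nil, S.adjMap_of_lt _ h]

end LocalSystem

/-- On a simply connected complex, a labeling is the coboundary of a function on the vertices. -/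
theorem exists_potential (hY : IsSimplyConnectedComplex Y.X) {l : Y.Edge → ℕ+}
    (hl : Y.IsLabeling l) :
    ∃ f : Y.V → ℤ, ∀ {a b : Y.V} (h : Y.lt a b), f b = f a + (l ⟨(a, b), h⟩ : ℕ) := by
  let S : LocalSystem Y (fun _ => ℤ) :=
    { map := fun {a b} h => Equiv.addRight ((l ⟨(a, b), h⟩ : ℕ) : ℤ)
      map_map := fun {a b c} hab hbc hac hs s => by
        simp only [Equiv.coe_addRight, ← hl a b c hab hbc hac hs]
        push_cast
        ring }
  obtain ⟨x⟩ := hY.connected.nonempty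
  obtain ⟨t, -, ht⟩ := S.exists_section hY x 0
  exact ⟨t, fun h => (ht h).symm⟩

end OrderedComplex

/-! ### The complex of a Garside lattice is simply connected -/

theorem WalkHomotopic.append_left {V : Type u} {X : AbstractSimplicialComplex V} {a b c : V}
    (r : (oneSkeleton X).Walk a b) {p q : (oneSkeleton X).Walk b c} (h : WalkHomotopic X p q) :
    WalkHomotopic X (r.append p) (r.append q) := by
  induction r with
  | nil => exact h
  | cons e r ih => exact .cons_congr e (ih h)

theorem WalkHomotopic.of_append_left {V : Type u} {X : AbstractSimplicialComplex V} {a b c : V}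
    (r : (oneSkeleton X).Walk a b) {p q : (oneSkeleton X).Walk b c}
    (h : WalkHomotopic X (r.append p) (r.append q)) : WalkHomotopic X p q := by
  induction r with
  | nil => exact h
  | cons e r ih =>
    exact ih (((WalkHomotopic.backtrack e.symm e _).symm.trans (.cons_congr e.symm h)).trans
      (.backtrack e.symm e _))

namespace LatticePair

variable {A : LatticePair.{u}}

theorem mem_complex_faces {s : Finset A.L} : s ∈ A.complex.faces ↔
    s.Nonempty ∧ ∀ a ∈ s, ∀ b ∈ s, (a ≤ b ∨ b ≤ a) ∧ b ≤ A.φ a := by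
  refine ⟨fun h => ⟨h.1, fun a ha b hb => ⟨h.2.1.total ha hb, h.2.2 a ha b hb⟩⟩,
    fun h => ⟨h.1, fun a ha b hb _ => (h.2 a ha b hb).1, fun a ha b hb => (h.2 a ha b hb).2⟩⟩

theorem adj_complex {a b : A.L} : (oneSkeleton A.complex).Adj a b ↔
    (a < b ∧ b ≤ A.φ a) ∨ (b < a ∧ a ≤ A.φ b) :=
  OrderedComplex.adj_iff (Y := A.toComplex)

theorem le_toComplex {a b : A.toComplex.V} :
    A.toComplex.le a b ↔ @LE.le A.L _ a b ∧ @LE.le A.L _ b (A.φ a) := by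
  constructor
  · rintro (rfl | ⟨h, h'⟩)
    · exact ⟨le_rfl, A.le_φ a⟩
    · exact ⟨h.le, h'⟩
  · rintro ⟨h, h'⟩
    rcases h.eq_or_lt with h | h
    · exact Or.inl h
    · exact Or.inr ⟨h, h'⟩

open Classical in
/-- The edge path of length at most one from `a` to `b`, where `a ≤ b ≤ φ a`. -/
noncomputable def weakEdge {a b : A.L} (h : a ≤ b ∧ b ≤ A.φ a) :
    (oneSkeleton A.complex).Walk a b :=
  if e : a = b then SimpleGraph.Walk.nil.copy rfl e
  else .cons (adj_complex.2 (.inl ⟨lt_of_le_of_ne h.1 e, h.2⟩)) .nil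

theorem weakEdge_self {a : A.L} (h : a ≤ a ∧ a ≤ A.φ a) : weakEdge h = .nil := by
  simp [weakEdge]

theorem weakEdge_of_ne {a b : A.L} (h : a ≤ b ∧ b ≤ A.φ a) (e : a ≠ b) :
    weakEdge h = .cons (adj_complex.2 (.inl ⟨lt_of_le_of_ne h.1 e, h.2⟩)) .nil := by
  simp [weakEdge, e]

theorem weakEdge_append_weakEdge {a b c d : A.L} (hab : a ≤ b ∧ b ≤ A.φ a)
    (hbc : b ≤ c ∧ c ≤ A.φ b) (hac : a ≤ c ∧ c ≤ A.φ a) (p : (oneSkeleton A.complex).Walk c d) :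
    WalkHomotopic A.complex ((weakEdge hab).append ((weakEdge hbc).append p))
      ((weakEdge hac).append p) := by
  classical
  by_cases e1 : a = b
  · subst e1
    rw [weakEdge_self]
    exact .refl _
  by_cases e2 : b = c
  · subst e2
    rw [weakEdge_self hbc]
    exact .refl _
  have e3 : a ≠ c := by
    rintro rfl
    exact e1 (le_antisymm hab.1 hbc.1)
  rw [weakEdge_of_ne _ e1, weakEdge_of_ne _ e2, weakEdge_of_ne _ e3]
  refine WalkHomotopic.triangle _ _ _ ⟨{a, b, c}, ?_, by simp, by simp, by simp⟩ p
  rw [mem_complex_faces]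
  have h1 := A.le_φ a
  have h2 := A.le_φ b
  have h3 := A.le_φ c
  have h4 := hab.1.trans h2
  have h5 := hbc.1.trans h3
  have h6 := hac.1.trans h3
  refine ⟨⟨a, by simp⟩, ?_⟩
  simp only [Finset.mem_insert, Finset.mem_singleton]
  rintro x (rfl | rfl | rfl) y (rfl | rfl | rfl) <;> simp [*]

theorem iterate_le_of_le (A : LatticePair.{u}) (m : A.L) {i j : ℕ} (h : i ≤ j) :
    A.φ^[i] m ≤ A.φ^[j] m :=
  monotone_nat_of_le_succ (f := fun k => A.φ^[k] m)
    (fun k => by rw [Function.iterate_succ_apply']; exact A.le_φ _) h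

theorem le_iterate (A : LatticePair.{u}) (m : A.L) (k : ℕ) : m ≤ A.φ^[k] m :=
  A.iterate_le_of_le m (Nat.zero_le k)

/-- Consecutive elements of the sequence `x ⊓ φ^k m` are joined by an edge or equal. The second
argument is allowed to grow from `x` to `y ≤ φ x`. -/
theorem inf_iterate_step (m : A.L) {x y : A.L} (h : x ≤ y ∧ y ≤ A.φ x) {i j : ℕ} (hij : i ≤ j)
    (hji : j ≤ i + 1) :
    x ⊓ A.φ^[i] m ≤ y ⊓ A.φ^[j] m ∧ y ⊓ A.φ^[j] m ≤ A.φ (x ⊓ A.φ^[i] m) := by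
  refine ⟨inf_le_inf h.1 (A.iterate_le_of_le m hij), ?_⟩
  rw [map_inf, ← Function.iterate_succ_apply' A.φ i m]
  exact inf_le_inf h.2 (A.iterate_le_of_le m hji)

/-- The edge path `m, x ⊓ φ m, x ⊓ φ² m, …, x ⊓ φ^k m`. -/
noncomputable def ladder {m : A.L} {x : A.L} (hx : m ≤ x) :
    ∀ k : ℕ, (oneSkeleton A.complex).Walk m (x ⊓ A.φ^[k] m)
  | 0 => weakEdge ⟨le_inf hx le_rfl, inf_le_right.trans (A.le_φ m)⟩
  | k + 1 => (ladder hx k).append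
      (weakEdge (inf_iterate_step m ⟨le_rfl, A.le_φ x⟩ k.le_succ le_rfl))

/-- Filling the squares between the edge paths `x ⊓ φ^k m` and `y ⊓ φ^k m`, where `x ≤ y ≤ φ x`. -/
theorem ladder_homotopic {m x y d : A.L} (hx : m ≤ x) (h : x ≤ y ∧ y ≤ A.φ x) (k : ℕ)
    (p : (oneSkeleton A.complex).Walk (y ⊓ A.φ^[k] m) d) :
    WalkHomotopic A.complex
      ((ladder hx k).append ((weakEdge (inf_iterate_step m h (le_refl k) k.le_succ)).append p))
      ((ladder (hx.trans h.1) k).append p) := by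
  induction k with
  | zero => exact weakEdge_append_weakEdge _ _ _ p
  | succ k ih =>
    simp only [ladder, ← SimpleGraph.Walk.append_assoc]
    refine .trans ?_ (ih _)
    apply WalkHomotopic.append_left
    exact (weakEdge_append_weakEdge _ _ (inf_iterate_step m h k.le_succ le_rfl) p).trans
      (weakEdge_append_weakEdge _ _ _ p).symm

/-- The edge path `m, x ⊓ φ m, x ⊓ φ² m, …, x` when `m ≤ x ≤ φ^k m`. -/
noncomputable def cone {m x : A.L} {k : ℕ} (hx : m ≤ x ∧ x ≤ A.φ^[k] m) :
    (oneSkeleton A.complex).Walk m x :=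
  (ladder hx.1 k).append (weakEdge ⟨inf_le_left, by rw [inf_eq_left.2 hx.2]; exact A.le_φ x⟩)

theorem cone_homotopic {m x y d : A.L} {k : ℕ} (hx : m ≤ x ∧ x ≤ A.φ^[k] m)
    (hy : m ≤ y ∧ y ≤ A.φ^[k] m) (h : x ≤ y ∧ y ≤ A.φ x)
    (p : (oneSkeleton A.complex).Walk y d) :
    WalkHomotopic A.complex ((cone hx).append ((weakEdge h).append p)) ((cone hy).append p) := by
  simp only [cone, ← SimpleGraph.Walk.append_assoc]
  refine .trans ?_ (ladder_homotopic hx.1 h k _)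
  apply WalkHomotopic.append_left
  exact (weakEdge_append_weakEdge _ _ ⟨inf_le_left.trans h.1, by
      rw [inf_eq_left.2 hx.2]; exact h.2⟩ p).trans (weakEdge_append_weakEdge _ _ _ p).symm

/-- The edge path `p` stays between `m` and `φ^k m`, so that it moves the end of the cone along. -/
theorem cone_append_homotopic {m x y : A.L} {k : ℕ} (p : (oneSkeleton A.complex).Walk x y)
    (hp : ∀ v ∈ p.support, m ≤ v ∧ v ≤ A.φ^[k] m) (hx : m ≤ x ∧ x ≤ A.φ^[k] m)
    (hy : m ≤ y ∧ y ≤ A.φ^[k] m) :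
    WalkHomotopic A.complex ((cone hx).append p) (cone hy) := by
  induction p with
  | nil => rw [SimpleGraph.Walk.append_nil]; exact .refl _
  | @cons x z y e p ih =>
    have hp' : ∀ v ∈ p.support, m ≤ v ∧ v ≤ A.φ^[k] m :=
      fun v hv => hp v (List.mem_cons_of_mem _ hv)
    have hz := hp' z p.start_mem_support
    refine .trans ?_ (ih hp' hz hy)
    rcases adj_complex.1 e with h | h
    · have := cone_homotopic hx hz ⟨h.1.le, h.2⟩ p
      rwa [weakEdge_of_ne _ h.1.ne] at this
    · refine (cone_homotopic hz hx ⟨h.1.le, h.2⟩ _).symm.trans ?_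
      rw [weakEdge_of_ne _ h.1.ne]
      exact WalkHomotopic.append_left _ (.backtrack _ _ _)

theorem exists_le_and_le_iterate (hA : A.IsGarside) (l : List A.L) :
    ∃ (m : A.L) (k : ℕ), ∀ v ∈ l, m ≤ v ∧ v ≤ A.φ^[k] m := by
  obtain ⟨m, hm⟩ : ∃ m : A.L, ∀ v ∈ l, m ≤ v := by
    induction l with
    | nil => exact ⟨hA.nonempty.some, by simp⟩
    | cons a l ih =>
      obtain ⟨m, hm⟩ := ih
      exact ⟨a ⊓ m, List.forall_mem_cons.2 ⟨inf_le_left, fun v hv => inf_le_right.trans (hm v hv)⟩⟩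
  obtain ⟨k, hk⟩ : ∃ k : ℕ, ∀ v ∈ l, v ≤ A.φ^[k] m := by
    clear hm
    induction l with
    | nil => exact ⟨0, by simp⟩
    | cons a l ih =>
      obtain ⟨k, hk⟩ := ih
      obtain ⟨j, hj⟩ := hA.cofinal a m
      exact ⟨max j k, List.forall_mem_cons.2 ⟨hj.trans (A.iterate_le_of_le m (le_max_left j k)),
        fun v hv => (hk v hv).trans (A.iterate_le_of_le m (le_max_right j k))⟩⟩
  exact ⟨m, k, fun v hv => ⟨hm v hv, hk v hv⟩⟩

theorem IsGarside.isSimplyConnectedComplex (hA : A.IsGarside) :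
    IsSimplyConnectedComplex A.complex where
  connected := by
    have := hA.nonempty
    refine ⟨fun x y => ?_⟩
    obtain ⟨m, k, h⟩ := exists_le_and_le_iterate hA [x, y]
    exact ⟨(cone (h x (by simp))).reverse.append (cone (h y (by simp)))⟩
  null_homotopic x p := by
    obtain ⟨m, k, h⟩ := exists_le_and_le_iterate hA p.support
    have hx := h x p.start_mem_support
    refine WalkHomotopic.of_append_left (cone hx) ?_
    rw [SimpleGraph.Walk.append_nil]
    exact cone_append_homotopic p h hx hx

theorem IsGarside.isUnlabeledGarside (hA : A.IsGarside) : A.toComplex.IsUnlabeledGarside where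
  flag s hs h := by
    refine mem_complex_faces.2 ⟨hs, fun a ha b hb => ?_⟩
    by_cases e : a = b
    · subst e
      exact ⟨.inl le_rfl, A.le_φ a⟩
    · rcases adj_complex.1 (h a ha b hb e) with ⟨h, h'⟩ | ⟨h, -⟩
      · exact ⟨.inl h.le, h'⟩
      · exact ⟨.inr h.le, h.le.trans (A.le_φ a)⟩
  simplyConnected := hA.isSimplyConnectedComplex
  le_iff a b := by
    rw [le_toComplex, le_toComplex]
    exact ⟨fun h => ⟨h.2, A.φ.monotone h.1⟩, fun h => ⟨A.φ.le_iff_le.1 h.2, h.1⟩⟩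
  interval x := by
    have mem : ∀ {z : A.L}, A.toComplex.le x z ∧ A.toComplex.le z (A.φ x) ↔
        @LE.le A.L _ x z ∧ z ≤ A.φ x := by
      intro z
      refine (and_congr le_toComplex le_toComplex).trans ⟨fun h => h.1, fun h => ⟨h, h.2, ?_⟩⟩
      exact A.φ.monotone h.1
    have key : ∀ a b : {z : A.L // A.toComplex.le x z ∧ A.toComplex.le z (A.φ x)},
        A.toComplex.le a.1 b.1 ↔ a.1 ≤ b.1 := by
      intro a b
      refine le_toComplex.trans ⟨fun h => h.1, fun h => ⟨h, ?_⟩⟩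
      exact (mem.1 b.2).2.trans (A.φ.monotone (mem.1 a.2).1)
    refine ⟨fun a => (key a a).2 le_rfl,
      fun a b h h' => Subtype.ext (le_antisymm (α := A.L) ((key a b).1 h) ((key b a).1 h')),
      fun a b c h h' => (key a c).2 (((key a b).1 h).trans ((key b c).1 h')),
      fun a b => ?_, fun a b => ?_⟩
    · let j : {z : A.L // A.toComplex.le x z ∧ A.toComplex.le z (A.φ x)} :=
        ⟨a.1 ⊔ b.1, mem.2 ⟨le_sup_of_le_left (mem.1 a.2).1, sup_le (mem.1 a.2).2 (mem.1 b.2).2⟩⟩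
      exact ⟨j, (key a j).2 le_sup_left, (key b j).2 le_sup_right,
        fun c h h' => (key j c).2 (sup_le ((key a c).1 h) ((key b c).1 h'))⟩
    · let j : {z : A.L // A.toComplex.le x z ∧ A.toComplex.le z (A.φ x)} :=
        ⟨a.1 ⊓ b.1, mem.2 ⟨le_inf (mem.1 a.2).1 (mem.1 b.2).1, inf_le_of_left_le (mem.1 a.2).2⟩⟩
      exact ⟨j, (key j a).2 inf_le_left, (key j b).2 inf_le_right,
        fun c h h' => (key c j).2 (le_inf ((key c a).1 h) ((key c b).1 h'))⟩

end LatticePair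

/-! ### Length functions and labelings -/

theorem OrderedComplex.reflTransGen_lt_iff {Y Y' : OrderedComplex.{u}} (e : Y.V ≃ Y'.V)
    (he : ∀ a b, Y'.lt (e a) (e b) ↔ Y.lt a b) {a b : Y.V} :
    Relation.ReflTransGen Y'.lt (e a) (e b) ↔ Relation.ReflTransGen Y.lt a b := by
  refine ⟨fun h => ?_, fun h => Relation.ReflTransGen.lift e (fun x y => (he x y).2) _ _ h⟩
  have h' : Relation.ReflTransGen Y.lt (e.symm (e a)) (e.symm (e b)) :=
    Relation.ReflTransGen.lift e.symm (fun x y hxy => (he _ _).1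
      (by rwa [e.apply_symm_apply, e.apply_symm_apply])) _ _ h
  rwa [e.symm_apply_apply, e.symm_apply_apply] at h'

namespace LatticePair

variable {A A' : LatticePair.{u}}

/-- Every inequality `a ≤ b` of a Garside lattice factors into edges of its complex, through the
elements `b ⊓ φ^k a`. -/
theorem IsGarside.reflTransGen_lt (hA : A.IsGarside) {a b : A.L} (h : a ≤ b) :
    Relation.ReflTransGen A.toComplex.lt a b := by
  obtain ⟨k, hk⟩ := hA.cofinal b a
  induction k generalizing a with
  | zero => exact le_antisymm h hk ▸ .refl
  | succ k ih =>
    have h1 : a ≤ b ⊓ A.φ a := le_inf h (A.le_φ a)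
    have h2 : b ≤ A.φ^[k] (b ⊓ A.φ a) := by
      have : ∀ (k : ℕ) (x y : A.L), A.φ^[k] (x ⊓ y) = A.φ^[k] x ⊓ A.φ^[k] y := by
        intro k
        induction k with
        | zero => exact fun x y => rfl
        | succ k ih => exact fun x y => by simp only [Function.iterate_succ_apply, map_inf, ih]
      rw [this]
      exact le_inf (A.le_iterate b k) (by rwa [← Function.iterate_succ_apply])
    rcases h1.eq_or_lt with e | h3
    · exact ih h (e ▸ h2)
    · exact .head ⟨h3, inf_le_right⟩ (ih inf_le_left h2)

theorem IsGarside.le_iff_reflTransGen_lt (hA : A.IsGarside) {a b : A.L} :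
    a ≤ b ↔ Relation.ReflTransGen A.toComplex.lt a b := by
  refine ⟨hA.reflTransGen_lt, fun h => ?_⟩
  induction h with
  | refl => exact le_rfl
  | tail _ h ih => exact le_trans (α := A.L) ih h.1.le

/-- Length functions are determined by their values on the edges of the complex. -/
theorem IsLength.eq_of_eq_on_edges (hA : A.IsGarside) {l l' : A.Pair → ℕ} (hl : A.IsLength l)
    (hl' : A.IsLength l')
    (h : ∀ (a b : A.L) (h : A.toComplex.lt a b), l ⟨(a, b), h.1.le⟩ = l' ⟨(a, b), h.1.le⟩) :
    l = l' := by
  have key : ∀ {a b : A.L}, Relation.ReflTransGen A.toComplex.lt a b → ∀ hab : a ≤ b,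
      l ⟨(a, b), hab⟩ = l' ⟨(a, b), hab⟩ := by
    intro a b hab
    induction hab with
    | refl => exact fun hab => ((hl.eq_zero_iff _).2 rfl).trans ((hl'.eq_zero_iff _).2 rfl).symm
    | @tail b c hab hbc ih =>
      intro hac
      have hab' : a ≤ b := hA.le_iff_reflTransGen_lt.2 hab
      exact (hl.add a b c hab' hbc.1.le).trans ((congrArg₂ (· + ·) (ih hab') (h b c hbc)).trans
        (hl'.add a b c hab' hbc.1.le).symm)
  funext ⟨⟨a, b⟩, hab⟩
  exact key (hA.reflTransGen_lt hab) hab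

theorem isLength_of_strictMono {f : A.L → ℤ} (hf : StrictMono f) :
    A.IsLength (fun p => (f p.1.2 - f p.1.1).toNat) where
  add a b c hab hbc := by
    have h1 := hf.monotone hab
    have h2 := hf.monotone hbc
    dsimp only
    omega
  eq_zero_iff := by
    rintro ⟨⟨a, b⟩, hab⟩
    dsimp only at hab ⊢
    rcases hab.eq_or_lt with rfl | h
    · simp
    · have := hf h
      exact ⟨fun h' => by omega, fun h' => absurd h' h.ne⟩

theorem IsLength.existsUnique_labeling {l : A.Pair → ℕ} (hl : A.IsLength l) :
    ∃! m, A.toComplex.IsLabeling m ∧ A.RestrictsTo l m := by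
  have pos : ∀ e : A.toComplex.Edge, 0 < l ⟨(e.1.1, e.1.2), e.2.1.le⟩ := fun e =>
    Nat.pos_of_ne_zero fun h => e.2.1.ne ((hl.eq_zero_iff _).1 h)
  refine ⟨fun e => ⟨l ⟨(e.1.1, e.1.2), e.2.1.le⟩, pos e⟩, ⟨fun a b c hab hbc hac _ => ?_,
    fun a b h => rfl⟩, fun m hm => ?_⟩
  · exact PNat.eq (hl.add a b c hab.1.le hbc.1.le).symm
  · funext ⟨⟨a, b⟩, h⟩
    exact PNat.eq (hm.2 a b h).symm

/-- The length function is the difference of a potential of the labeling. -/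
theorem existsUnique_length (hA : A.IsGarside) {m : A.toComplex.Edge → ℕ+}
    (hm : A.toComplex.IsLabeling m) : ∃! l, A.IsLength l ∧ A.RestrictsTo l m := by
  obtain ⟨f, hf⟩ := OrderedComplex.exists_potential hA.isSimplyConnectedComplex hm
  have mono : Monotone (α := A.L) f := by
    intro a b hab
    induction hA.reflTransGen_lt hab with
    | refl => exact le_rfl
    | tail _ h ih => exact (ih (hA.le_iff_reflTransGen_lt.2 ‹_›)).trans (by rw [hf h]; omega)
  have smono : StrictMono (α := A.L) f := by
    intro a b hab
    refine lt_of_le_of_ne (mono hab.le) fun h => ?_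
    rcases Relation.ReflTransGen.cases_head (hA.reflTransGen_lt hab.le) with h' | ⟨c, hac, hcb⟩
    · exact hab.ne h'
    · have h1 := hf hac
      have h2 := mono (hA.le_iff_reflTransGen_lt.2 hcb)
      have h3 := (m ⟨(a, c), hac⟩).pos
      omega
  refine ⟨_, ⟨isLength_of_strictMono smono, fun a b h => ?_⟩, fun l hl => ?_⟩
  · have := hf h
    dsimp only
    omega
  · refine hl.1.eq_of_eq_on_edges hA (isLength_of_strictMono smono) fun a b h => ?_
    have h1 := hf h
    have h2 := hl.2 a b h
    dsimp only
    omega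

/-- If the labeling is invariant, then both `l` and its pullback along `φ` are length functions that
restrict to it, so they agree. -/
theorem IsLength.isInvariant_iff (hA : A.IsGarside) {l : A.Pair → ℕ} {m : A.toComplex.Edge → ℕ+}
    (hl : A.IsLength l) (hlm : A.RestrictsTo l m) :
    A.IsInvariant l ↔ A.toComplex.IsInvariant m := by
  constructor
  · intro h a b hab
    exact PNat.eq (((hlm _ _ _).symm.trans (h a b hab.1.le)).trans (hlm a b hab))
  · intro h
    have hl' : A.IsLength (fun p => l ⟨(A.φ p.1.1, A.φ p.1.2), A.φ.monotone p.2⟩) :=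
      ⟨fun a b c hab hbc => hl.add _ _ _ _ _,
        fun p => (hl.eq_zero_iff _).trans A.φ.injective.eq_iff⟩
    have := hl'.eq_of_eq_on_edges hA hl fun a b hab =>
      (hlm _ _ ((A.toComplex.φ_lt a b).2 hab)).trans
        ((congrArg PNat.val (h a b hab)).trans (hlm a b hab).symm)
    exact fun a b hab => congrFun this ⟨(a, b), hab⟩

theorem IsGarside.isNonequivariantGarsideFlag (hA : A.IsGarside) :
    A.toComplex.IsNonequivariantGarsideFlag :=
  let ⟨_, hl⟩ := hA.homogeneous
  ⟨hA.isUnlabeledGarside, hl.existsUnique_labeling.exists.imp fun _ h => h.1⟩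

theorem IsEquivariantGarside.isGarsideFlag (hA : A.IsEquivariantGarside) :
    A.toComplex.IsGarsideFlag :=
  let ⟨_, hl, hi⟩ := hA.2
  ⟨hA.1.isUnlabeledGarside, hl.existsUnique_labeling.exists.imp fun _ h =>
    ⟨h.1, (hl.isInvariant_iff hA.1 h.2).1 hi⟩⟩

theorem iso_iff_toComplex_iso (hA : A.IsGarside) (hA' : A'.IsGarside) :
    A.Iso A' ↔ A.toComplex.Iso A'.toComplex := by
  constructor
  · rintro ⟨e, he⟩
    have faces : ∀ s : Finset A.L,
        s.map e.toEquiv.toEmbedding ∈ A'.complex.faces ↔ s ∈ A.complex.faces := by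
      intro s
      rw [mem_complex_faces, mem_complex_faces]
      simp only [Finset.map_nonempty, Finset.forall_mem_map]
      refine and_congr_right fun _ => forall₂_congr fun a _ => forall₂_congr fun b _ => ?_
      change (e a ≤ e b ∨ e b ≤ e a) ∧ e b ≤ A'.φ (e a) ↔ _
      rw [← he, e.le_iff_le, e.le_iff_le, e.le_iff_le]
    have lt : ∀ a b : A.L, e a < e b ∧ e b ≤ A'.φ (e a) ↔ a < b ∧ b ≤ A.φ a := by
      intro a b
      rw [← he, e.lt_iff_lt, e.le_iff_le]
    exact ⟨e.toEquiv, faces, lt, he⟩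
  · rintro ⟨e, -, hlt, hφ⟩
    refine ⟨⟨e, fun {a b} => ?_⟩, hφ⟩
    refine hA'.le_iff_reflTransGen_lt.trans (Iff.trans ?_ hA.le_iff_reflTransGen_lt.symm)
    exact OrderedComplex.reflTransGen_lt_iff (Y := A.toComplex) (Y' := A'.toComplex) e hlt

end LatticePair

/-! ### Normal sequences in a Garside flag complex -/

/-- A downward induction on the integers. -/
theorem int_down_induction {P : ℤ → Prop} {N : ℤ} (h : ∀ k ≥ N, P k)
    (step : ∀ k, P (k + 1) → P k) (k : ℤ) : P k := by
  rcases le_total N k with hk | hk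
  · exact h k hk
  · obtain ⟨n, rfl⟩ : ∃ n : ℕ, k = N - n := ⟨(N - k).toNat, by omega⟩
    clear hk
    induction n with
    | zero => exact h _ (by simp)
    | succ n ih => exact step _ (by rwa [Nat.cast_succ, sub_add_eq_sub_sub, sub_add_cancel])

namespace OrderedComplex

variable {Y : OrderedComplex.{u}}

theorem le_rfl {a : Y.V} : Y.le a a := Or.inl rfl

theorem le_antisymm {a b : Y.V} (h : Y.le a b) (h' : Y.le b a) : a = b := by
  rcases h with h | h
  · exact h
  rcases h' with h' | h'
  · exact h'.symm
  · exact absurd h' (Y.lt_asymm _ _ h)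

theorem le.map_φ {a b : Y.V} (h : Y.le a b) : Y.le (Y.φ a) (Y.φ b) :=
  h.imp (congrArg Y.φ) (Y.φ_lt a b).2

theorem le_of_map_φ {a b : Y.V} (h : Y.le (Y.φ a) (Y.φ b)) : Y.le a b :=
  h.imp (fun h => Y.φ.injective h) (Y.φ_lt a b).1

theorem le.reflTransGen {a b : Y.V} (h : Y.le a b) : Relation.ReflTransGen Y.lt a b := by
  rcases h with rfl | h
  · exact .refl
  · exact .single h

theorem reflTransGen_φ {a b : Y.V} :
    Relation.ReflTransGen Y.lt (Y.φ a) (Y.φ b) ↔ Relation.ReflTransGen Y.lt a b :=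
  reflTransGen_lt_iff Y.φ Y.φ_lt

theorem φ_zpow (x : Y.V) (k : ℤ) :
    Y.φ (((Y.φ : Equiv.Perm Y.V) ^ (k - 1)) x) = ((Y.φ : Equiv.Perm Y.V) ^ k) x := by
  rw [← Equiv.Perm.mul_apply, mul_self_zpow, sub_add_cancel]

/-- The vertex `m` is the meet of `a` and `b` among the vertices `z` with `x ≤ z` (equivalently,
with `x ≤ z` and `z ≤ φ x`). -/
structure IsMeet (x a b m : Y.V) : Prop where
  base_left : Y.le x a
  base_right : Y.le x b
  base : Y.le x m
  left : Y.le m a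
  right : Y.le m b
  greatest : ∀ c, Y.le x c → Y.le c a → Y.le c b → Y.le c m

theorem IsMeet.unique {x a b m m' : Y.V} (h : IsMeet x a b m) (h' : IsMeet x a b m') : m = m' :=
  le_antisymm (h'.greatest m h.base h.left h.right) (h.greatest m' h'.base h'.left h'.right)

theorem IsMeet.map_φ {x a b m : Y.V} (h : IsMeet x a b m) :
    IsMeet (Y.φ x) (Y.φ a) (Y.φ b) (Y.φ m) where
  base_left := h.base_left.map_φ
  base_right := h.base_right.map_φ
  base := h.base.map_φ
  left := h.left.map_φ
  right := h.right.map_φ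
  greatest c hc ha hb := by
    obtain ⟨c, rfl⟩ := Y.φ.surjective c
    exact (h.greatest c (le_of_map_φ hc) (le_of_map_φ ha) (le_of_map_φ hb)).map_φ

theorem IsMeet.of_map_φ {x a b m : Y.V} (h : IsMeet (Y.φ x) (Y.φ a) (Y.φ b) (Y.φ m)) :
    IsMeet x a b m where
  base_left := le_of_map_φ h.base_left
  base_right := le_of_map_φ h.base_right
  base := le_of_map_φ h.base
  left := le_of_map_φ h.left
  right := le_of_map_φ h.right
  greatest _ hc ha hb := le_of_map_φ (h.greatest _ hc.map_φ ha.map_φ hb.map_φ)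

/-- The sequence `m : ℤ → V` is a normal sequence from `x` to `v`. In a Garside lattice the only one
is `k ↦ v ⊓ φ^k x`, which these local conditions characterize. -/
structure IsNormal (x v : Y.V) (m : ℤ → Y.V) : Prop where
  bot : ∃ N : ℤ, ∀ k ≤ N, m k = ((Y.φ : Equiv.Perm Y.V) ^ k) x
  top : ∃ N : ℤ, ∀ k ≥ N, m k = v
  isMeet : ∀ k, IsMeet (m k) (m (k + 1)) (Y.φ (m (k - 1))) (m k)

/-- The sequence `m'` lifts `m` along an edge: if `m` is `k ↦ v ⊓ φ^k x`, then `m'` is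
`k ↦ w ⊓ φ^k x`, for some `w` with `v ≤ w ≤ φ v`. -/
def IsLift (m m' : ℤ → Y.V) : Prop :=
  ∀ k, IsMeet (m k) (m' (k + 1)) (Y.φ (m (k - 1))) (m' k)

/-- Lifts are determined from the top downwards. -/
theorem IsLift.eq {m m' m'' : ℤ → Y.V} (h' : IsLift m m') (h'' : IsLift m m'') {w : Y.V}
    (t' : ∃ N : ℤ, ∀ k ≥ N, m' k = w) (t'' : ∃ N : ℤ, ∀ k ≥ N, m'' k = w) : m' = m'' := by
  obtain ⟨N', hN'⟩ := t'
  obtain ⟨N'', hN''⟩ := t''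
  funext k
  refine int_down_induction (P := fun k => m' k = m'' k) (N := max N' N'') (fun k hk => ?_)
    (fun k hk => ?_) k
  · rw [hN' k ((le_max_left _ _).trans hk), hN'' k ((le_max_right _ _).trans hk)]
  · exact (hk ▸ h' k).unique (h'' k)

namespace IsUnlabeledGarside

theorem le_φ (hY : Y.IsUnlabeledGarside) (a : Y.V) : Y.le a (Y.φ a) := (hY.le_iff a a).1 le_rfl

/-- Transitivity among the vertices above a common vertex `x`. -/
theorem trans (hY : Y.IsUnlabeledGarside) {x a b c : Y.V} (xa : Y.le x a) (xb : Y.le x b)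
    (xc : Y.le x c) (hab : Y.le a b) (hbc : Y.le b c) : Y.le a c :=
  (hY.interval x).trans ⟨a, xa, (hY.le_iff x a).1 xa⟩ ⟨b, xb, (hY.le_iff x b).1 xb⟩
    ⟨c, xc, (hY.le_iff x c).1 xc⟩ hab hbc

theorem exists_isMeet (hY : Y.IsUnlabeledGarside) {x a b : Y.V} (xa : Y.le x a)
    (xb : Y.le x b) : ∃ m, IsMeet x a b m := by
  obtain ⟨m, h1, h2, h3⟩ := (hY.interval x).meet ⟨a, xa, (hY.le_iff x a).1 xa⟩
    ⟨b, xb, (hY.le_iff x b).1 xb⟩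
  exact ⟨m.1, xa, xb, m.2.1, h1, h2, fun c xc => h3 ⟨c, xc, (hY.le_iff x c).1 xc⟩⟩

theorem exists_join (hY : Y.IsUnlabeledGarside) {x a b : Y.V} (xa : Y.le x a)
    (xb : Y.le x b) : ∃ j, Y.le x j ∧ Y.le a j ∧ Y.le b j ∧
      ∀ c, Y.le x c → Y.le a c → Y.le b c → Y.le j c := by
  obtain ⟨j, h1, h2, h3⟩ := (hY.interval x).join ⟨a, xa, (hY.le_iff x a).1 xa⟩
    ⟨b, xb, (hY.le_iff x b).1 xb⟩
  exact ⟨j.1, j.2.1, h1, h2, fun c xc => h3 ⟨c, xc, (hY.le_iff x c).1 xc⟩⟩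

/-- The lift of a normal sequence along an edge exists: it is constructed from the top downwards. -/
theorem exists_isLift (hY : Y.IsUnlabeledGarside) {x v w : Y.V} {m : ℤ → Y.V}
    (hm : IsNormal x v m) (h : Y.le v w) :
    ∃ m', IsLift m m' ∧ ∃ N : ℤ, ∀ k ≥ N, m' k = w := by
  classical
  obtain ⟨N, hN⟩ := hm.top
  have ex : ∀ x a b : Y.V, ∃ m, Y.le x a → Y.le x b → IsMeet x a b m := by
    intro x a b
    by_cases h : Y.le x a ∧ Y.le x b
    · exact (hY.exists_isMeet h.1 h.2).imp fun m hm _ _ => hm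
    · exact ⟨x, fun h1 h2 => absurd ⟨h1, h2⟩ h⟩
  choose meet meet_spec using ex
  -- `g n` is the value of the lift at the index `N + 1 - n`.
  let g : ℕ → Y.V := fun n => n.rec w fun n z => meet (m (N - n)) z (Y.φ (m (N - n - 1)))
  have g_succ : ∀ n : ℕ, g (n + 1) = meet (m (N - n)) (g n) (Y.φ (m (N - n - 1))) := fun _ => rfl
  have g_le : ∀ n : ℕ, Y.le (g n) (Y.φ (m (N - n))) ∧
      IsMeet (m (N - n)) (g n) (Y.φ (m (N - n - 1))) (g (n + 1)) := by
    have aux : ∀ n : ℕ, Y.le (g n) (Y.φ (m (N - n))) →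
        IsMeet (m (N - n)) (g n) (Y.φ (m (N - n - 1))) (g (n + 1)) := by
      intro n hn
      rw [g_succ]
      exact meet_spec _ _ _ ((hY.le_iff _ _).2 hn) (hm.isMeet _).base_right
    intro n
    induction n with
    | zero =>
      have h0 : Y.le (g 0) (Y.φ (m (N - (0 : ℕ)))) := by
        rw [hN _ (by simp)]
        exact (hY.le_iff _ _).1 h
      exact ⟨h0, aux 0 h0⟩
    | succ n ih =>
      have h1 : Y.le (g (n + 1)) (Y.φ (m (N - (n + 1 : ℕ)))) := by
        have := ih.2.right
        rwa [sub_sub] at this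
      exact ⟨h1, aux _ h1⟩
  refine ⟨fun k => g (N + 1 - k).toNat, fun k => ?_, N + 1, fun k hk => ?_⟩
  · dsimp only
    rcases le_or_gt k N with hk | hk
    · obtain ⟨n, rfl⟩ : ∃ n : ℕ, k = N - n := ⟨(N - k).toNat, by omega⟩
      have e1 : (N + 1 - (N - n + 1)).toNat = n := by omega
      have e2 : (N + 1 - (N - n)).toNat = n + 1 := by omega
      rw [e1, e2]
      exact (g_le n).2
    · have e1 : (N + 1 - (k + 1)).toNat = 0 := by omega
      have e2 : (N + 1 - k).toNat = 0 := by omega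
      rw [e1, e2, hN k hk.le, hN (k - 1) (by omega)]
      exact ⟨h, hY.le_φ v, h, le_rfl, (hY.le_iff _ _).1 h, fun c _ hc _ => hc⟩
  · have e : (N + 1 - k).toNat = 0 := by omega
    dsimp only
    rw [e]
    rfl

theorem le_φ_of_isLift (hY : Y.IsUnlabeledGarside) {m m' : ℤ → Y.V} (h : IsLift m m') (k : ℤ) :
    Y.le (m' (k + 1)) (Y.φ (m k)) := (hY.le_iff _ _).1 (h k).base_left

/-- Normality of `m` at `k - 1`, shifted by `φ`, and used after adding a join. In a Garside lattice
with `m k = v ⊓ φ^k x` and `m' k = w ⊓ φ^k x`, the reason is that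
`φ v ⊓ φ w ⊓ φ^k x ≤ φ v ⊓ φ^k x`. -/
theorem le_φ_of_le_φ_lift (hY : Y.IsUnlabeledGarside) {x v : Y.V} {m m' : ℤ → Y.V}
    (hm : IsNormal x v m) (h : IsLift m m') {k : ℤ} {p : Y.V} (h1 : Y.le (m' k) p)
    (h2 : Y.le p (Y.φ (m k))) (h3 : Y.le p (Y.φ (m' (k - 1)))) : Y.le p (Y.φ (m (k - 1))) := by
  have hk := h (k - 1)
  have nk := hm.isMeet (k - 1)
  rw [sub_add_cancel] at hk nk
  have b1 : Y.le (m' k) (Y.φ (m (k - 1))) := (h k).right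
  have b2 : Y.le (m' k) (Y.φ (m' (k - 1))) := (hY.le_iff _ _).1 hk.left
  have b3 : Y.le (m' k) (Y.φ (m k)) := (hY.le_iff _ _).1 (h k).base
  obtain ⟨q, bq, pq, mq, hq⟩ := hY.exists_join h1 b1
  have q1 : Y.le q (Y.φ (m k)) := hq _ b3 h2 nk.left.map_φ
  have q2 : Y.le q (Y.φ (m' (k - 1))) := hq _ b2 h3 hk.base.map_φ
  have q3 : Y.le q (Y.φ (Y.φ (m (k - 1 - 1)))) :=
    hY.trans mq hk.base.map_φ nk.base_right.map_φ q2 hk.right.map_φ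
  have q4 := nk.map_φ.greatest q mq q1 q3
  rwa [le_antisymm mq q4]

theorem isNormal_of_isLift (hY : Y.IsUnlabeledGarside) {x v w : Y.V} {m m' : ℤ → Y.V}
    (hm : IsNormal x v m) (h : IsLift m m') (ht : ∃ N : ℤ, ∀ k ≥ N, m' k = w) :
    IsNormal x w m' where
  bot := by
    obtain ⟨N, hN⟩ := hm.bot
    refine ⟨N, fun k hk => ?_⟩
    have h1 := (h k).base
    have h2 := (h k).right
    rw [hN (k - 1) (by omega), φ_zpow] at h2
    rw [hN k hk] at h1
    exact le_antisymm h2 h1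
  top := ht
  isMeet k := by
    have hk := h (k - 1)
    rw [sub_add_cancel] at hk
    refine ⟨(h k).left, (hY.le_iff _ _).1 hk.left, le_rfl, (h k).left,
      (hY.le_iff _ _).1 hk.left, fun c c1 c2 c3 => ?_⟩
    have c4 : Y.le c (Y.φ (m k)) := hY.trans c1 (h k).left ((hY.le_iff _ _).1 (h k).base) c2
      (hY.le_φ_of_isLift h k)
    exact (h k).greatest c ((hY.le_iff _ _).2 c4) c2 (hY.le_φ_of_le_φ_lift hm h c1 c4 c3)

/-- Lifting is compatible with triangles `u ≤ v ≤ w ≤ φ u`. -/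
theorem isLift_of_isLift_of_isLift (hY : Y.IsUnlabeledGarside) {x u w : Y.V}
    {m m' m'' : ℤ → Y.V} (hm : IsNormal x u m) (h : IsLift m m') (h' : IsLift m' m'')
    (ht : ∃ N : ℤ, ∀ k ≥ N, m'' k = w) (huw : Y.le u w) : IsLift m m'' := by
  have le_of : ∀ k, Y.le (m'' (k + 1)) (Y.φ (m k)) → Y.le (m'' k) (Y.φ (m k)) := fun k hk =>
    hY.trans (h' k).base (h' k).base_left ((hY.le_iff _ _).1 (h k).base) (h' k).left hk
  have step : ∀ k, Y.le (m'' (k + 1)) (Y.φ (m k)) → Y.le (m'' k) (Y.φ (m (k - 1))) := fun k hk =>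
    hY.le_φ_of_le_φ_lift hm h (h' k).base (le_of k hk) (h' k).right
  obtain ⟨N, hN⟩ := ht
  obtain ⟨N', hN'⟩ := hm.top
  have key : ∀ k, Y.le (m'' (k + 1)) (Y.φ (m k)) := by
    refine int_down_induction (N := max N N') (fun k hk => ?_) fun k hk => ?_
    · rw [hN (k + 1) (by omega), hN' k (by omega)]
      exact (hY.le_iff _ _).1 huw
    · have := step _ hk
      rwa [add_sub_cancel_right] at this
  intro k
  have b1 : Y.le (m k) (m'' (k + 1)) := (hY.le_iff _ _).2 (key k)
  have b2 : Y.le (m k) (Y.φ (m (k - 1))) := (hm.isMeet k).base_right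
  have b3 : Y.le (m k) (m'' k) := (hY.le_iff _ _).2 (le_of k (key k))
  refine ⟨b1, b2, b3, (h' k).left, step k (key k), fun c c0 c1 c2 => ?_⟩
  -- The vertex `c` need not be above `m' k`, but its join with `m'' k` is.
  obtain ⟨j, bj, cj, mj, hj⟩ := hY.exists_join c0 b3
  have j1 : Y.le j (m'' (k + 1)) := hj _ b1 c1 (h' k).left
  have j2 : Y.le j (Y.φ (m (k - 1))) := hj _ b2 c2 (step k (key k))
  have j3 : Y.le (m' k) j := hY.trans (h k).base b3 bj (h' k).base mj
  have hk := h (k - 1)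
  have hk' := h' (k - 1)
  rw [sub_add_cancel] at hk hk'
  have j4 : Y.le j (Y.φ (m' (k - 1))) :=
    hY.trans j3 (h k).right ((hY.le_iff _ _).1 hk.left) j2 hk.base.map_φ
  exact hY.trans c0 bj b3 cj ((h' k).greatest j j3 j1 j4)

/-- Applying `φ` and shifting the indices is lifting along the edge from `v` to `φ v`. -/
theorem isLift_shift (hY : Y.IsUnlabeledGarside) {x v : Y.V} {m : ℤ → Y.V}
    (hm : IsNormal x v m) : IsLift m (fun k => Y.φ (m (k - 1))) := by
  intro k
  have nk := hm.isMeet (k - 1)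
  dsimp only
  rw [sub_add_cancel] at nk
  rw [add_sub_cancel_right]
  exact ⟨hY.le_φ _, (hm.isMeet k).base_right, (hm.isMeet k).base_right, nk.left.map_φ, le_rfl,
    fun c _ _ hc => hc⟩

/-! ### The local system of normal sequences -/

/-- Lifting along an edge, as a map between the sets of normal sequences from `x`. -/
noncomputable def lift (hY : Y.IsUnlabeledGarside) {x v w : Y.V} (h : Y.le v w)
    (m : {m : ℤ → Y.V // IsNormal x v m}) : {m : ℤ → Y.V // IsNormal x w m} :=
  ⟨(hY.exists_isLift m.2 h).choose, hY.isNormal_of_isLift m.2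
    (hY.exists_isLift m.2 h).choose_spec.1 (hY.exists_isLift m.2 h).choose_spec.2⟩

theorem isLift_lift (hY : Y.IsUnlabeledGarside) {x v w : Y.V} (h : Y.le v w)
    (m : {m : ℤ → Y.V // IsNormal x v m}) : IsLift m.1 (hY.lift h m).1 :=
  (hY.exists_isLift m.2 h).choose_spec.1

theorem lift_lift (hY : Y.IsUnlabeledGarside) {x u v w : Y.V} (huv : Y.le u v) (hvw : Y.le v w)
    (huw : Y.le u w) (m : {m : ℤ → Y.V // IsNormal x u m}) :
    hY.lift hvw (hY.lift huv m) = hY.lift huw m :=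
  Subtype.ext ((hY.isLift_of_isLift_of_isLift m.2 (hY.isLift_lift huv m)
    (hY.isLift_lift hvw _) (hY.lift hvw _).2.top huw).eq (hY.isLift_lift huw m)
    (hY.lift hvw _).2.top (hY.lift huw m).2.top)

theorem lift_le_φ (hY : Y.IsUnlabeledGarside) {x v : Y.V}
    (m : {m : ℤ → Y.V // IsNormal x v m}) (k : ℤ) :
    (hY.lift (hY.le_φ v) m).1 k = Y.φ (m.1 (k - 1)) := by
  refine congrFun ((hY.isLift_lift (hY.le_φ v) m).eq (hY.isLift_shift m.2)
    (hY.lift (hY.le_φ v) m).2.top ?_) k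
  obtain ⟨N, hN⟩ := m.2.top
  exact ⟨N + 1, fun k hk => congrArg Y.φ (hN _ (by omega))⟩

theorem lift_injective (hY : Y.IsUnlabeledGarside) {x v w : Y.V} (h : Y.le v w) :
    Function.Injective (hY.lift (x := x) h) := by
  intro m m' e
  -- Lifting on from `w` to `φ v` gives the shift of the sequence, which is injective.
  have e' := congrArg (hY.lift ((hY.le_iff v w).1 h)) e
  rw [hY.lift_lift _ _ (hY.le_φ v), hY.lift_lift _ _ (hY.le_φ v)] at e'
  ext k
  have := congrFun (congrArg Subtype.val e') (k + 1)
  rw [hY.lift_le_φ, hY.lift_le_φ, add_sub_cancel_right] at this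
  exact Y.φ.injective this

theorem lift_surjective (hY : Y.IsUnlabeledGarside) {x v w : Y.V} (h : Y.le v w) :
    Function.Surjective (hY.lift (x := x) h) := by
  intro n
  obtain ⟨w, rfl⟩ := Y.φ.surjective w
  have hn : IsNormal x w (fun k => Y.φ.symm (n.1 (k + 1))) := by
    refine ⟨?_, ?_, fun k => IsMeet.of_map_φ ?_⟩
    · obtain ⟨N, hN⟩ := n.2.bot
      refine ⟨N - 1, fun k hk => ?_⟩
      rw [hN (k + 1) (by omega), ← φ_zpow, Equiv.symm_apply_apply, add_sub_cancel_right]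
    · obtain ⟨N, hN⟩ := n.2.top
      refine ⟨N, fun k hk => ?_⟩
      rw [hN (k + 1) (by omega), Equiv.symm_apply_apply]
    · simp only [Equiv.apply_symm_apply, sub_add_cancel]
      simpa only [add_sub_cancel_right] using n.2.isMeet (k + 1)
  -- The preimage is obtained by undoing the shift and lifting from `φ⁻¹ w` to `v`.
  refine ⟨hY.lift ((hY.le_iff w v).2 h) ⟨_, hn⟩, ?_⟩
  rw [hY.lift_lift _ _ (hY.le_φ w)]
  ext k
  rw [hY.lift_le_φ]
  simp only [Equiv.apply_symm_apply, sub_add_cancel]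

/-- The normal sequences from `x` form a local system. -/
noncomputable def normalSystem (hY : Y.IsUnlabeledGarside) (x : Y.V) :
    LocalSystem Y (fun v => {m : ℤ → Y.V // IsNormal x v m}) where
  map h := Equiv.ofBijective (hY.lift (Or.inr h)) ⟨hY.lift_injective _, hY.lift_surjective _⟩
  map_map hab hbc hac _ s := hY.lift_lift (.inr hab) (.inr hbc) (.inr hac) s

/-- The sequence `x ⊓ φ^k x`, which is constant for `k ≥ 0`. -/
theorem isNormal_self (hY : Y.IsUnlabeledGarside) (x : Y.V) :
    IsNormal x x (fun k => ((Y.φ : Equiv.Perm Y.V) ^ (min k 0)) x) := by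
  refine ⟨⟨0, fun k hk => by rw [min_eq_left hk]⟩,
    ⟨0, fun k hk => by rw [min_eq_right hk]; rfl⟩, fun k => ?_⟩
  rcases lt_or_ge k 0 with hk | hk
  · rw [min_eq_left (by omega : k ≤ 0), min_eq_left (by omega : k + 1 ≤ 0),
      min_eq_left (by omega : k - 1 ≤ 0), φ_zpow]
    have h : Y.le (((Y.φ : Equiv.Perm Y.V) ^ k) x) (((Y.φ : Equiv.Perm Y.V) ^ (k + 1)) x) := by
      rw [← φ_zpow x (k + 1), add_sub_cancel_right]
      exact hY.le_φ _
    exact ⟨h, le_rfl, le_rfl, h, le_rfl, fun c _ _ hc => hc⟩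
  · rw [min_eq_right (by omega : 0 ≤ k), min_eq_right (by omega : 0 ≤ k + 1)]
    have h : Y.le (((Y.φ : Equiv.Perm Y.V) ^ (0 : ℤ)) x)
        (Y.φ (((Y.φ : Equiv.Perm Y.V) ^ (min (k - 1) 0)) x)) := by
      rcases eq_or_lt_of_le hk with rfl | hk
      · rw [min_eq_left (by omega), φ_zpow]
        exact le_rfl
      · rw [min_eq_right (by omega)]
        exact hY.le_φ _
    exact ⟨le_rfl, h, le_rfl, le_rfl, h, fun c _ hc _ => hc⟩

/-- The function `M` assigns to each vertex `v` a normal sequence from `x` to `v`, compatibly with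
the edges; `M v k` plays the role of `v ⊓ φ^k x`. -/
structure IsNormalFamily (x : Y.V) (M : Y.V → ℤ → Y.V) : Prop where
  isNormal : ∀ v, IsNormal x v (M v)
  self : ∀ k, M x k = ((Y.φ : Equiv.Perm Y.V) ^ (min k 0)) x
  isLift : ∀ {v w}, Y.le v w → IsLift (M v) (M w)

theorem exists_isNormalFamily (hY : Y.IsUnlabeledGarside) (x : Y.V) :
    ∃ M : Y.V → ℤ → Y.V, IsNormalFamily x M := by
  obtain ⟨t, tx, ht⟩ := (hY.normalSystem x).exists_section hY.simplyConnected x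
    ⟨_, hY.isNormal_self x⟩
  refine ⟨fun v => (t v).1, fun v => (t v).2, fun k => by rw [tx], fun {v w} h => ?_⟩
  rcases h with rfl | h
  · exact (t v).2.isMeet
  · rw [← ht h]
    exact hY.isLift_lift (Or.inr h) (t v)

end IsUnlabeledGarside
end OrderedComplex

/-! ### From Garside flag complexes to Garside lattices -/

namespace OrderedComplex

open Relation (ReflTransGen)

variable {Y : OrderedComplex.{u}}

namespace IsUnlabeledGarside

theorem reflTransGen_iterate (hY : Y.IsUnlabeledGarside) (x : Y.V) (k : ℕ) :
    ReflTransGen Y.lt x (Y.φ^[k] x) := by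
  induction k with
  | zero => exact .refl
  | succ k ih =>
    rw [Function.iterate_succ_apply']
    exact ih.trans (hY.le_φ _).reflTransGen

theorem exists_iterate_above_of_reflTransGen (hY : Y.IsUnlabeledGarside) {x y : Y.V}
    (h : ReflTransGen Y.lt x y) : ∃ k : ℕ, ReflTransGen Y.lt y (Y.φ^[k] x) := by
  induction h with
  | refl => exact ⟨0, .refl⟩
  | @tail y z _ hyz ih =>
    obtain ⟨k, hk⟩ := ih
    refine ⟨k + 1, ?_⟩
    rw [Function.iterate_succ_apply']
    exact ((hY.le_iff y z).1 (.inr hyz)).reflTransGen.trans (reflTransGen_φ.2 hk)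

end IsUnlabeledGarside

namespace IsUnlabeledGarside.IsNormalFamily

variable {x : Y.V} {M : Y.V → ℤ → Y.V}

theorem le_succ (hM : IsNormalFamily x M) (v : Y.V) (k : ℤ) : Y.le (M v k) (M v (k + 1)) :=
  ((hM.isNormal v).isMeet k).left

theorem reflTransGen_of_le (hM : IsNormalFamily x M) (v : Y.V) {i j : ℤ} (h : i ≤ j) :
    ReflTransGen Y.lt (M v i) (M v j) := by
  induction j, h using Int.leInduction with
  | base => exact .refl
  | succ j _ ih => exact ih.trans (hM.le_succ v j).reflTransGen

theorem reflTransGen_right (hM : IsNormalFamily x M) (v : Y.V) (k : ℤ) :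
    ReflTransGen Y.lt (M v k) v := by
  obtain ⟨N, hN⟩ := (hM.isNormal v).top
  have := hM.reflTransGen_of_le v (le_max_left k N)
  rwa [hN _ (le_max_right k N)] at this

theorem reflTransGen_left (hY : Y.IsUnlabeledGarside) (hM : IsNormalFamily x M) (v : Y.V) (k : ℤ) :
    ReflTransGen Y.lt (M v k) (((Y.φ : Equiv.Perm Y.V) ^ k) x) := by
  obtain ⟨N, hN⟩ := (hM.isNormal v).bot
  rcases le_total k N with hk | hk
  · rw [hN k hk]
  · induction k, hk using Int.leInduction with
    | base => rw [hN N _root_.le_rfl]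
    | succ k _ ih =>
      have h := ((hY.le_iff _ _).1 (hM.le_succ v k)).reflTransGen.trans (reflTransGen_φ.2 ih)
      rwa [← φ_zpow x (k + 1), add_sub_cancel_right]

theorem mono (hM : IsNormalFamily x M) {v w : Y.V} (h : ReflTransGen Y.lt v w) (k : ℤ) :
    ReflTransGen Y.lt (M v k) (M w k) := by
  induction h with
  | refl => exact .refl
  | tail _ h ih => exact ih.trans (hM.isLift (.inr h) k).base.reflTransGen

theorem map_φ (hY : Y.IsUnlabeledGarside) (hM : IsNormalFamily x M) (v : Y.V) (k : ℤ) :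
    M (Y.φ v) k = Y.φ (M v (k - 1)) := by
  obtain ⟨N, hN⟩ := (hM.isNormal v).top
  exact congrFun ((hM.isLift (hY.le_φ v)).eq (hY.isLift_shift (hM.isNormal v))
    (hM.isNormal _).top ⟨N + 1, fun k hk => congrArg Y.φ (hN _ (by omega))⟩) k

theorem eq_zpow (hM : IsNormalFamily x M) {v : Y.V} (h : ReflTransGen Y.lt x v) {k : ℤ}
    (hk : k ≤ 0) : M v k = ((Y.φ : Equiv.Perm Y.V) ^ k) x := by
  induction h generalizing k with
  | refl => rw [hM.self, min_eq_left hk]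
  | @tail v w _ h ih =>
    have h1 := (hM.isLift (.inr h) k).base
    have h2 := (hM.isLift (.inr h) k).right
    rw [ih (by omega), φ_zpow] at h2
    rw [ih hk] at h1
    exact le_antisymm h2 h1

/-- If `M y k = y`, that is, `y ≤ φ^k x`, for all `k ≥ j`, then the same holds for every `z` below
`y`. -/
theorem eq_self_of_reflTransGen (hY : Y.IsUnlabeledGarside) (hM : IsNormalFamily x M) {z y : Y.V}
    (h : ReflTransGen Y.lt z y) {j : ℤ} (hy : ∀ k ≥ j, M y k = y) : ∀ k ≥ j, M z k = z := by
  induction h using ReflTransGen.head_induction_on with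
  | refl => exact hy
  | @head v w hvw _ hw =>
    obtain ⟨N, hN⟩ := (hM.isNormal v).top
    intro k
    refine int_down_induction (P := fun k => k ≥ j → M v k = v) (fun k hk _ => hN k hk)
      (fun k ih hk => ?_) k
    have nk := (hM.isNormal v).isMeet k
    have lk := hM.isLift (.inr hvw) k
    rw [ih (by omega)] at nk
    rw [hw k hk] at lk
    exact le_antisymm nk.left (nk.greatest v nk.base_left le_rfl
      (hY.trans nk.base_left lk.base lk.base_right (.inr hvw) lk.right))

end IsUnlabeledGarside.IsNormalFamily

namespace IsUnlabeledGarside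

/-- The meet of `x` and `v` is the term with index `0` of the normal sequence from `x` to `v`. -/
theorem exists_meet_reflTransGen (hY : Y.IsUnlabeledGarside) (x v : Y.V) :
    ∃ m, ReflTransGen Y.lt m x ∧ ReflTransGen Y.lt m v ∧
      ∀ z, ReflTransGen Y.lt z x → ReflTransGen Y.lt z v → ReflTransGen Y.lt z m := by
  obtain ⟨M, hM⟩ := hY.exists_isNormalFamily x
  refine ⟨M v 0, hM.reflTransGen_left hY v 0, hM.reflTransGen_right v 0, fun z hzx hzv => ?_⟩
  have h := hM.eq_self_of_reflTransGen hY hzx (j := 0)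
    (fun k hk => by rw [hM.self, min_eq_right hk]; rfl) 0 _root_.le_rfl
  have h' := hM.mono hzv 0
  rwa [h] at h'

/-- The interval from `a` to `φ a` for the transitive closure consists of the vertices that are
joined to `a` by an edge, besides `a` itself: the normal sequence from `a` to `b` reaches `b` in one
step. -/
theorem le_of_reflTransGen (hY : Y.IsUnlabeledGarside) {a b : Y.V} (h : ReflTransGen Y.lt a b)
    (h' : ReflTransGen Y.lt b (Y.φ a)) : Y.le a b := by
  obtain ⟨M, hM⟩ := hY.exists_isNormalFamily a
  have h0 : M b 0 = a := hM.eq_zpow h _root_.le_rfl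
  have h1 : M b (0 + 1) = b := by
    refine hM.eq_self_of_reflTransGen hY h' (j := 1) (fun k hk => ?_) _ (by norm_num)
    rw [hM.map_φ hY, hM.self, min_eq_right (by omega)]
    rfl
  have := hM.le_succ b 0
  rwa [h0, h1] at this

theorem exists_iterate_above (hY : Y.IsUnlabeledGarside) (x y : Y.V) :
    ∃ k : ℕ, ReflTransGen Y.lt x (Y.φ^[k] y) := by
  obtain ⟨m, hx, hy, -⟩ := hY.exists_meet_reflTransGen x y
  obtain ⟨k, hk⟩ := hY.exists_iterate_above_of_reflTransGen hx
  refine ⟨k, hk.trans ?_⟩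
  clear hk
  induction k with
  | zero => exact hy
  | succ k ih =>
    rw [Function.iterate_succ_apply', Function.iterate_succ_apply']
    exact reflTransGen_φ.2 ih

/-- A function on the vertices that increases along the edges. -/
theorem exists_strictMono (hY : Y.IsUnlabeledGarside) (hl : ∃ l : Y.Edge → ℕ+, Y.IsLabeling l) :
    ∃ f : Y.V → ℤ, ∀ {a b : Y.V}, ReflTransGen Y.lt a b → a = b ∨ f a < f b := by
  obtain ⟨l, hl⟩ := hl
  obtain ⟨f, hf⟩ := exists_potential hY.simplyConnected hl
  refine ⟨f, fun {a b} h => ?_⟩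
  induction h with
  | refl => exact Or.inl rfl
  | @tail b c _ h ih =>
    have h1 := hf h
    have h2 := (l ⟨(b, c), h⟩).pos
    refine Or.inr ?_
    rcases ih with rfl | ih <;> omega

/-- The transitive closure of the order on the edges is a lattice. The join of two vertices is an
upper bound with the least potential. -/
theorem isLatticeRel (hY : Y.IsUnlabeledGarside) (hl : ∃ l : Y.Edge → ℕ+, Y.IsLabeling l) :
    IsLatticeRel (ReflTransGen Y.lt) := by
  obtain ⟨f, hf⟩ := hY.exists_strictMono hl
  refine ⟨fun a => .refl, fun a b h h' => ?_, fun a b c => .trans, fun a b => ?_,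
    fun a b => hY.exists_meet_reflTransGen a b⟩
  · rcases hf h with h | h
    · exact h
    rcases hf h' with h' | h'
    · exact h'.symm
    · omega
  · obtain ⟨k, hk⟩ := hY.exists_iterate_above a b
    obtain ⟨n, ⟨j, haj, hbj, rfl⟩, hn⟩ := Int.exists_least_of_bdd
      (P := fun n => ∃ j, ReflTransGen Y.lt a j ∧ ReflTransGen Y.lt b j ∧ f j = n)
      ⟨f a, by
        rintro _ ⟨j, haj, -, rfl⟩
        rcases hf haj with rfl | h
        · exact _root_.le_rfl
        · exact h.le⟩
      ⟨_, _, hk, hY.reflTransGen_iterate b k, rfl⟩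
    refine ⟨j, haj, hbj, fun c hac hbc => ?_⟩
    obtain ⟨m, hmj, hmc, hm⟩ := hY.exists_meet_reflTransGen j c
    rcases hf hmj with rfl | h
    · exact hmc
    · exact absurd (hn _ ⟨m, hm a haj hac, hm b hbj hbc, rfl⟩) h.not_ge

end IsUnlabeledGarside

/-- The lattice of a Garside flag complex: its order is the transitive closure of the order on the
edges. -/
noncomputable def toLatticePair (hY : Y.IsUnlabeledGarside)
    (hl : ∃ l : Y.Edge → ℕ+, Y.IsLabeling l) : LatticePair.{u} where
  L := Y.V
  lat := (hY.isLatticeRel hl).toLattice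
  φ :=
    letI := (hY.isLatticeRel hl).toLattice
    { Y.φ with map_rel_iff' := reflTransGen_φ }
  le_φ x := (hY.le_φ x).reflTransGen

theorem isGarside_toLatticePair (hY : Y.IsUnlabeledGarside)
    (hl : ∃ l : Y.Edge → ℕ+, Y.IsLabeling l) : (toLatticePair hY hl).IsGarside where
  nonempty := hY.simplyConnected.connected.nonempty
  homogeneous := by
    obtain ⟨f, hf⟩ := hY.exists_strictMono hl
    refine ⟨_, LatticePair.isLength_of_strictMono (A := toLatticePair hY hl) (f := f)
      fun a b h => (hf h.le).resolve_left h.ne⟩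
  cofinal x y := hY.exists_iterate_above x y

theorem toComplex_toLatticePair_lt (hY : Y.IsUnlabeledGarside)
    (hl : ∃ l : Y.Edge → ℕ+, Y.IsLabeling l) (a b : Y.V) :
    (toLatticePair hY hl).toComplex.lt a b ↔ Y.lt a b := by
  constructor
  · rintro ⟨h, h'⟩
    exact (hY.le_of_reflTransGen h.le h').resolve_left h.ne
  · intro h
    have hne : a ≠ b := by
      rintro rfl
      exact Y.lt_asymm _ _ h h
    exact ⟨lt_of_le_of_ne (α := (toLatticePair hY hl).L) (.single h) hne,
      ((hY.le_iff a b).1 (.inr h)).reflTransGen⟩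

/-- Both complexes are flag and they have the same edges. -/
theorem toComplex_toLatticePair_faces (hY : Y.IsUnlabeledGarside)
    (hl : ∃ l : Y.Edge → ℕ+, Y.IsLabeling l) (s : Finset Y.V) :
    s ∈ (toLatticePair hY hl).toComplex.X.faces ↔ s ∈ Y.X.faces := by
  have adj : ∀ a b : Y.V, (oneSkeleton (toLatticePair hY hl).toComplex.X).Adj a b ↔
      (oneSkeleton Y.X).Adj a b := fun a b =>
    adj_iff.trans ((or_congr (toComplex_toLatticePair_lt hY hl a b)
      (toComplex_toLatticePair_lt hY hl b a)).trans adj_iff.symm)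
  constructor
  · intro hs
    exact hY.flag s hs.1 fun a ha b hb hab => (adj a b).1 ⟨hab, s, hs, ha, hb⟩
  · intro hs
    exact (isGarside_toLatticePair hY hl).isUnlabeledGarside.flag s
      (Y.X.isRelLowerSet_faces hs).1 fun a ha b hb hab => (adj a b).2 ⟨hab, s, hs, ha, hb⟩

theorem toComplex_toLatticePair_iso (hY : Y.IsUnlabeledGarside)
    (hl : ∃ l : Y.Edge → ℕ+, Y.IsLabeling l) : (toLatticePair hY hl).toComplex.Iso Y := by
  refine ⟨Equiv.refl Y.V, fun s => ?_, fun a b => (toComplex_toLatticePair_lt hY hl a b).symm,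
    fun a => rfl⟩
  have h : s.map (Equiv.refl Y.V).toEmbedding = s := Finset.map_refl
  exact (Iff.of_eq (congrArg (· ∈ Y.X.faces) h)).trans
    (toComplex_toLatticePair_faces hY hl s).symm

theorem isEquivariantGarside_toLatticePair (hY : Y.IsUnlabeledGarside)
    (hl : ∃ l : Y.Edge → ℕ+, Y.IsLabeling l)
    (hi : ∃ l : Y.Edge → ℕ+, Y.IsLabeling l ∧ Y.IsInvariant l) :
    (toLatticePair hY hl).IsEquivariantGarside := by
  obtain ⟨l, hl', hi⟩ := hi
  have hA := isGarside_toLatticePair hY hl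
  let m : (toLatticePair hY hl).toComplex.Edge → ℕ+ :=
    fun e => l ⟨e.1, (toComplex_toLatticePair_lt hY hl _ _).1 e.2⟩
  have hm : (toLatticePair hY hl).toComplex.IsLabeling m := by
    rintro a b c hab hbc hac ⟨s, hs, h⟩
    exact hl' a b c _ _ _ ⟨s, (toComplex_toLatticePair_faces hY hl s).1 hs, h⟩
  obtain ⟨k, ⟨hk, hkm⟩, -⟩ := LatticePair.existsUnique_length hA hm
  exact ⟨hA, k, hk, (hk.isInvariant_iff hA hkm).2 fun a b hab => hi a b _⟩

end OrderedComplex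

theorem bijection_toComplex : BijectionUpToIso LatticePair.Iso.{u} OrderedComplex.Iso.{u}
    LatticePair.IsGarside OrderedComplex.IsNonequivariantGarsideFlag LatticePair.toComplex where
  maps_to _ hA := hA.isNonequivariantGarsideFlag
  iso_iff _ _ hA hA' := LatticePair.iso_iff_toComplex_iso hA hA'
  surjective _ hY := ⟨_, OrderedComplex.isGarside_toLatticePair hY.1 hY.2,
    OrderedComplex.toComplex_toLatticePair_iso hY.1 hY.2⟩

theorem bijection_toComplex_equivariant :
    BijectionUpToIso LatticePair.Iso.{u} OrderedComplex.Iso.{u}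
      LatticePair.IsEquivariantGarside OrderedComplex.IsGarsideFlag LatticePair.toComplex where
  maps_to _ hA := hA.isGarsideFlag
  iso_iff _ _ hA hA' := LatticePair.iso_iff_toComplex_iso hA.1 hA'.1
  surjective _ hY :=
    let hl := hY.2.imp fun _ h => h.1
    ⟨_, OrderedComplex.isEquivariantGarside_toLatticePair hY.1 hl hY.2,
      OrderedComplex.toComplex_toLatticePair_iso hY.1 hl⟩

end Garside

theorem theorem4p7 :
    -- Garside lattices and connected special categorical Garside structures
    Garside.BijectionUpToIso Garside.LatticePair.Iso.{u} Garside.CatTriple.Iso.{u}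
      Garside.LatticePair.IsGarside Garside.CatTriple.IsConnectedSpecialGarside
      Garside.LatticePair.toCat ∧
    -- the same, with invariant length functions on both sides
    Garside.BijectionUpToIso Garside.LatticePair.Iso.{u} Garside.CatTriple.Iso.{u}
      Garside.LatticePair.IsEquivariantGarside
      Garside.CatTriple.IsEquivariantConnectedSpecialGarside
      Garside.LatticePair.toCat ∧
    -- Garside lattices with an invariant length function and Garside flag complexes
    Garside.BijectionUpToIso Garside.LatticePair.Iso.{u} Garside.OrderedComplex.Iso.{u}
      Garside.LatticePair.IsEquivariantGarside Garside.OrderedComplex.IsGarsideFlag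
      Garside.LatticePair.toComplex ∧
    -- all Garside lattices, with labels that need not be preserved on the other side
    Garside.BijectionUpToIso Garside.LatticePair.Iso.{u} Garside.OrderedComplex.Iso.{u}
      Garside.LatticePair.IsGarside Garside.OrderedComplex.IsNonequivariantGarsideFlag
      Garside.LatticePair.toComplex ∧
    -- the length functions and labelings on corresponding objects correspond to each other
    ∀ A : Garside.LatticePair.{u}, A.IsGarside →
      (∀ l : A.Pair → ℕ, (A.IsLength l ↔ A.toCat.IsLength (A.homLength l)) ∧
        (A.IsInvariant l ↔ A.toCat.IsInvariant (A.homLength l))) ∧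
      (∀ l : A.Pair → ℕ, A.IsLength l → ∃! m, A.toComplex.IsLabeling m ∧ A.RestrictsTo l m) ∧
      (∀ m : A.toComplex.Edge → ℕ+, A.toComplex.IsLabeling m →
        ∃! l, A.IsLength l ∧ A.RestrictsTo l m) ∧
      (∀ (l : A.Pair → ℕ) (m : A.toComplex.Edge → ℕ+), A.IsLength l → A.RestrictsTo l m →
        (A.IsInvariant l ↔ A.toComplex.IsInvariant m)) := by
  refine ⟨Garside.bijection_toCat, Garside.bijection_toCat_equivariant,
    Garside.bijection_toComplex_equivariant, Garside.bijection_toComplex, fun A hA => ⟨fun l =>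
    ⟨Garside.LatticePair.isLength_homLength_iff l, Garside.LatticePair.isInvariant_homLength_iff l⟩,
    fun l hl => hl.existsUnique_labeling,
    fun m hm => Garside.LatticePair.existsUnique_length hA hm,
    fun l m hl hlm => hl.isInvariant_iff hA hlm⟩⟩
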